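/- Let $X$ be a set with at least two points and let $d:X\times X\to[0,\infty)$ be a quasi-metric: $d(x,y)=0$ iff $x=y$, and there are constants $C_0,C_1\in(0,\infty)$ with $d(y,x)\le C_0\,d(x,y)$ and $d(x,y)\le C_1\max\{d(x,z),d(z,y)\}$ for all $x,y,z\in X$. Put $B_d(x,r)=\{y\in X:d(x,y)<r\}$, and call $O\subseteq X$ open if for each $x\in O$ there is $r>0$ with $B_d(x,r)\subseteq O$. Let $\mu$ be a nonnegative measure on a $\sigma$-algebra that contains all open sets and all balls, with $0<\mu(B_d(x,r))<\infty$ for all $x\in X$ and $r\in(0,\infty)$. Assume that $\mu(X)<\infty$ and that, for some $s\in(0,\infty)$, $\mu$ is locally lower $s$-Ahlfors-regular: there is $b\in(0,\infty)$ with $\mu(B_d(x,r))\ge b\,r^s$ for all $x\in X$ and $r\in(0,1]$. Let $\alpha,p\in(0,\infty)$ and $q\in(0,\infty]$, and let $u:X\to\mathbb R$ be measurable. An $\alpha$-fractional gradient of $u$ is a sequence $\vec g=(g_k)_{k\in\mathbb Z}$ of measurable functions $g_k:X\to[0,\infty]$ for which there is a measurable set $E$ with $\mu(E)=0$ such that $|u(x)-u(y)|\le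 d(x,y)^\alpha\,(g_k(x)+g_k(y))$ for all $k\in\mathbb Z$ and $x,y\in X\setminus E$ with $2^{-k-1}\le d(x,y)<2^{-k}$. An $\alpha$-gradient of $u$ is a measurable function $g:X\to[0,\infty]$ for which there is a measurable set $E$ with $\mu(E)=0$ such that $|u(x)-u(y)|\le d(x,y)^\alpha\,(g(x)+g(y))$ for all $x,y\in X\setminus E$. The spaces $M^\alpha_{p,q}$ (Hajłasz–Triebel–Lizorkin), $N^\alpha_{p,q}$ (Hajłasz–Besov) and $M^{\alpha,p}$ (Hajłasz–Sobolev) consist of the measurable functions $u\in L^p(X,\mu)$ for which, respectively, $$\inf_{\vec g}\big\|\,\|(g_k)_k\|_{\ell^q(\mathbb Z)}\big\|_{L^p(X,\mu)},\qquad \inf_{\vec g}\big\|\big(\|g_k\|_{L^p(X,\mu)}\big)_k\big\|_{\ell^q(\mathbb Z)},\qquad \inf_{g}\|g\|_{L^p(X,\mu)}$$ is finite, where the infima are over all $\alpha$-fractional gradients $\vec g$, respectively all $\alpha$-gradients $g$, of $u$; the (quasi-)norm is $\|u\|_{L^p(X,\mu)}$ plus this infimum. For $\beta\in(0,\infty)$,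 $\mathcal C^\beta=\mathcal C^\beta(X,d)$ is the space of functions $f:X\to\mathbb R$ with $$\|f\|_{\mathcal C^\beta}=\sup_{x}|f(x)|+\sup_{x\ne y}\frac{|f(x)-f(y)|}{d(x,y)^\beta}<\infty.$$ An embedding $A\hookrightarrow B$ is continuous if there is a finite constant $C$ such that every $u\in A$ agrees $\mu$-almost everywhere with some $v\in B$ with $\|v\|_B\le C\|u\|_A$; it is compact if it is continuous and, for every bounded sequence in $A$, the corresponding sequence in $B$ has a subsequence that converges in $B$. Then the following hold for all $\alpha,p\in(0,\infty)$ and $q\in(0,\infty]$. 1. If $\alpha p<s$, then $M^{\alpha,p}\hookrightarrow L^{sp/(s-\alpha p)}(X,\mu)$ is continuous, and for every $\tilde p\in(0,sp/(s-\alpha p))$ the embeddings of $M^{\alpha,p}$, $M^\alpha_{p,q}$ and $N^\alpha_{p,q}$ into $L^{\tilde p}(X,\mu)$ are compact. 2. If $\alpha p>s$, then $M^{\alpha,p}\hookrightarrow\mathcal C^{\alpha-s/p}$ is continuous, and for every $\gamma\in(0,\alpha-s/p)$ the embeddings of $M^{\alpha,p}$, $M^\alpha_{p,q}$ and $N^\alpha_{p,q}$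 into $\mathcal C^\gamma$ are compact. In particular, the embeddings of $M^{\alpha,p}$, $M^\alpha_{p,q}$ and $N^\alpha_{p,q}$ into $L^{\tilde p}(X,\mu)$ are compact for every $\tilde p\in(0,\infty)$. -/

import Mathlib

open MeasureTheory Filter Topology
open scoped ENNReal NNReal

namespace QMM

variable {X : Type*}

/-- `d` is a quasi-metric on `X`: nonnegative, vanishing exactly on the diagonal, quasi-symmetric and
quasi-ultrametric. -/
structure IsQuasiMetric (d : X → X → ℝ) : Prop where
  nonneg : ∀ x y, 0 ≤ d x y
  eq_zero_iff : ∀ x y, d x y = 0 ↔ x = y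
  quasi_symm : ∃ C₀ : ℝ, 0 < C₀ ∧ ∀ x y, d y x ≤ C₀ * d x y
  quasi_triangle : ∃ C₁ : ℝ, 0 < C₁ ∧ ∀ x y z, d x y ≤ C₁ * max (d x z) (d z y)

/-- The quasi-metric ball `B_d(x,r)`. -/
def qball (d : X → X → ℝ) (x : X) (r : ℝ) : Set X := {y | d x y < r}

/-- The topology `τ_d`: a set is open if around each of its points it contains a ball. -/
@[reducible]
def qtopology (d : X → X → ℝ) : TopologicalSpace X where
  IsOpen O := ∀ x ∈ O, ∃ r : ℝ, 0 < r ∧ qball d x r ⊆ O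
  isOpen_univ := fun _ _ => ⟨1, one_pos, Set.subset_univ _⟩
  isOpen_inter := by
    rintro O U hO hU x ⟨hxO, hxU⟩
    obtain ⟨r₁, h₁, hr₁⟩ := hO x hxO
    obtain ⟨r₂, h₂, hr₂⟩ := hU x hxU
    refine ⟨min r₁ r₂, lt_min h₁ h₂, fun y hy => ⟨hr₁ ?_, hr₂ ?_⟩⟩
    · exact lt_of_lt_of_le (show d x y < min r₁ r₂ from hy) (min_le_left _ _)
    · exact lt_of_lt_of_le (show d x y < min r₁ r₂ from hy) (min_le_right _ _)
  isOpen_sUnion := by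
    rintro S hS x ⟨O, hOS, hxO⟩
    obtain ⟨r, hr, h⟩ := hS O hOS x hxO
    exact ⟨r, hr, h.trans (Set.subset_sUnion_of_mem hOS)⟩

/-- `(X, d, μ)` is a quasi-metric-measure space: `X` has at least two points, `d` is a quasi-metric,
the sigma-algebra on which `μ` is defined contains the Borel sets of `τ_d` and all balls, and balls
have positive and finite measure. -/
structure IsQuasiMetricMeasureSpace [MeasurableSpace X] (d : X → X → ℝ) (μ : Measure X) : Prop where
  nontrivial : Nontrivial X
  quasiMetric : IsQuasiMetric d
  borel_le : @borel X (qtopology d) ≤ (inferInstance : MeasurableSpace X)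
  measurableSet_qball : ∀ x r, 0 < r → MeasurableSet (qball d x r)
  measure_qball_pos : ∀ x r, 0 < r → 0 < μ (qball d x r)
  measure_qball_lt_top : ∀ x r, 0 < r → μ (qball d x r) < ∞

/-- `μ` is locally lower `s`-Ahlfors-regular. -/
def IsLocallyLowerAhlforsRegular [MeasurableSpace X] (d : X → X → ℝ) (μ : Measure X) (s : ℝ) : Prop :=
  ∃ b : ℝ, 0 < b ∧ ∀ (x : X) (r : ℝ), 0 < r → r ≤ 1 → ENNReal.ofReal (b * r ^ s) ≤ μ (qball d x r)

/-- `g` is an `α`-fractional gradient of `u`. Gradients may take the value `∞`. -/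
def IsFractionalGradient [MeasurableSpace X] (d : X → X → ℝ) (μ : Measure X) (α : ℝ)
    (u : X → ℝ) (g : ℤ → X → ℝ≥0∞) : Prop :=
  (∀ k, Measurable (g k)) ∧
    ∃ E : Set X, MeasurableSet E ∧ μ E = 0 ∧
      ∀ (k : ℤ) (x y : X), x ∉ E → y ∉ E → (2 : ℝ) ^ (-k - 1) ≤ d x y → d x y < (2 : ℝ) ^ (-k) →
        ENNReal.ofReal |u x - u y| ≤ ENNReal.ofReal (d x y ^ α) * (g k x + g k y)

/-- `g` is an `α`-gradient of `u`. Gradients may take the value `∞`. -/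
def IsHajlaszGradient [MeasurableSpace X] (d : X → X → ℝ) (μ : Measure X) (α : ℝ)
    (u : X → ℝ) (g : X → ℝ≥0∞) : Prop :=
  Measurable g ∧
    ∃ E : Set X, MeasurableSet E ∧ μ E = 0 ∧
      ∀ x y : X, x ∉ E → y ∉ E →
        ENNReal.ofReal |u x - u y| ≤ ENNReal.ofReal (d x y ^ α) * (g x + g y)

/-- The `ℓ^q(ℤ)` (quasi-)norm of a sequence in `[0,∞]`, for `q ∈ (0,∞]`. -/
noncomputable def lqNorm (q : ℝ≥0∞) (a : ℤ → ℝ≥0∞) : ℝ≥0∞ :=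
  if q = ∞ then ⨆ k, a k else (∑' k, a k ^ q.toReal) ^ (1 / q.toReal)

/-- A space of real functions on `X` (functions being identified when equal almost everywhere, where
this applies), with its (quasi-)norm. -/
structure FunctionSpace (X : Type*) where
  carrier : Set (X → ℝ)
  norm : (X → ℝ) → ℝ≥0∞

/-- `L^p(X, μ)`. -/
noncomputable def lebesgueSpace [MeasurableSpace X] (μ : Measure X) (p : ℝ≥0∞) :
    FunctionSpace X where
  carrier := {u | MemLp u p μ}
  norm u := eLpNorm u p μ

/-- The homogeneous Hajlasz-Sobolev semi-norm. -/
noncomputable def hajlaszSobolevSeminorm [MeasurableSpace X] (d : X → X → ℝ) (μ : Measure X)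
    (α : ℝ) (p : ℝ≥0∞) (u : X → ℝ) : ℝ≥0∞ :=
  ⨅ (g : X → ℝ≥0∞) (_ : IsHajlaszGradient d μ α u g), eLpNorm g p μ

/-- The homogeneous Hajlasz-Triebel-Lizorkin semi-norm, from the norms of gradients in
`L^p(X; ℓ^q(ℤ))`. -/
noncomputable def triebelLizorkinSeminorm [MeasurableSpace X] (d : X → X → ℝ) (μ : Measure X)
    (α : ℝ) (p q : ℝ≥0∞) (u : X → ℝ) : ℝ≥0∞ :=
  ⨅ (g : ℤ → X → ℝ≥0∞) (_ : IsFractionalGradient d μ α u g),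
    eLpNorm (fun x => lqNorm q (fun k => g k x)) p μ

/-- The homogeneous Hajlasz-Besov semi-norm, from the norms of gradients in `ℓ^q(ℤ; L^p(X))`. -/
noncomputable def besovSeminorm [MeasurableSpace X] (d : X → X → ℝ) (μ : Measure X)
    (α : ℝ) (p q : ℝ≥0∞) (u : X → ℝ) : ℝ≥0∞ :=
  ⨅ (g : ℤ → X → ℝ≥0∞) (_ : IsFractionalGradient d μ α u g),
    lqNorm q (fun k => eLpNorm (g k) p μ)

/-- The inhomogeneous Hajlasz-Sobolev space `M^{α,p}(X, d, μ)`. -/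
noncomputable def hajlaszSobolev [MeasurableSpace X] (d : X → X → ℝ) (μ : Measure X)
    (α : ℝ) (p : ℝ≥0∞) : FunctionSpace X where
  carrier := {u | Measurable u ∧ MemLp u p μ ∧ hajlaszSobolevSeminorm d μ α p u < ∞}
  norm u := eLpNorm u p μ + hajlaszSobolevSeminorm d μ α p u

/-- The inhomogeneous Hajlasz-Triebel-Lizorkin space `M^α_{p,q}(X, d, μ)`. -/
noncomputable def hajlaszTriebelLizorkin [MeasurableSpace X] (d : X → X → ℝ) (μ : Measure X)
    (α : ℝ) (p q : ℝ≥0∞) : FunctionSpace X where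
  carrier := {u | Measurable u ∧ MemLp u p μ ∧ triebelLizorkinSeminorm d μ α p q u < ∞}
  norm u := eLpNorm u p μ + triebelLizorkinSeminorm d μ α p q u

/-- The inhomogeneous Hajlasz-Besov space `N^α_{p,q}(X, d, μ)`. -/
noncomputable def hajlaszBesov [MeasurableSpace X] (d : X → X → ℝ) (μ : Measure X)
    (α : ℝ) (p q : ℝ≥0∞) : FunctionSpace X where
  carrier := {u | Measurable u ∧ MemLp u p μ ∧ besovSeminorm d μ α p q u < ∞}
  norm u := eLpNorm u p μ + besovSeminorm d μ α p q u

/-- The homogeneous Hölder semi-norm of order `β`. -/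
noncomputable def holderSeminorm (d : X → X → ℝ) (β : ℝ) (f : X → ℝ) : ℝ≥0∞ :=
  ⨆ (x : X) (y : X) (_ : x ≠ y), ENNReal.ofReal (|f x - f y| / d x y ^ β)

/-- The inhomogeneous Hölder norm of order `β`. -/
noncomputable def holderNorm (d : X → X → ℝ) (β : ℝ) (f : X → ℝ) : ℝ≥0∞ :=
  (⨆ x : X, ENNReal.ofReal |f x|) + holderSeminorm d β f

/-- The inhomogeneous Hölder space `𝒞^β(X, d)`. -/
noncomputable def holderSpace (d : X → X → ℝ) (β : ℝ) : FunctionSpace X where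
  carrier := {f | holderNorm d β f < ∞}
  norm := holderNorm d β

/-- `A ↪ B` continuously: each `u` in `A` agrees `μ`-almost everywhere with a member of `B`, whose
norm is at most a fixed constant times that of `u`. -/
def EmbedsContinuously [MeasurableSpace X] (μ : Measure X) (A B : FunctionSpace X) : Prop :=
  ∃ C : ℝ≥0, ∀ u ∈ A.carrier, ∃ v ∈ B.carrier, v =ᵐ[μ] u ∧ B.norm v ≤ C * A.norm u

/-- `A ↪ B` compactly: the embedding is continuous, and each sequence that is bounded in `A` has a
subsequence that converges in `B`. -/
def EmbedsCompactly [MeasurableSpace X] (μ : Measure X) (A B : FunctionSpace X) : Prop :=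
  EmbedsContinuously μ A B ∧
    ∀ u : ℕ → X → ℝ, (∀ n, u n ∈ A.carrier) → (∃ R : ℝ≥0, ∀ n, A.norm (u n) ≤ R) →
      ∃ φ : ℕ → ℕ, StrictMono φ ∧
        ∃ v : ℕ → X → ℝ, (∀ n, v n ∈ B.carrier ∧ v n =ᵐ[μ] u (φ n)) ∧
          ∃ w ∈ B.carrier, Tendsto (fun n => B.norm (v n - w)) atTop (𝓝 0)

end QMM

namespace QMM

variable {X : Type*}

/-! Fix $u$ in $M^{\alpha,p}$ and a measurable $h$ that dominates $|u|$ and is a gradient of $u$ off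
a null set $E$ (`Admissible`), scaled so that $\int h^p\le\Lambda^p b/2$. On $S_j=\{h\le\Lambda
M^j\}\setminus E$ the function $u$ is $\alpha$-Hölder with constant $2\Lambda M^j$. By Chebyshev and
lower regularity the complement of $S_j$ is too small to contain a ball of radius $\rho^j$,
$\rho=M^{-p/s}$ (`exists_mem_level`). So any point of $S_k$ can be joined to $S_0$ through
$S_{k-1},S_{k-2},\dots$ by steps of length below $\rho^j$. The step into $S_j$ changes $u$ by at
most $2\Lambda M\theta^j$ with $\theta=M\rho^\alpha=M^{1-\alpha p/s}$ (`exists_chain`). No doubling,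
averaging or covering argument is needed, and every $p>0$ is allowed.

If $\alpha p<s$, then $\theta>1$ and $|u|\lesssim\Lambda\theta^k$ on $S_k$. With $P=sp/(s-\alpha p)$
one has $\theta^P=M^p$, so $|u|^P\lesssim\Lambda^P(1+(Mh/\Lambda)^p)$ almost everywhere, which
integrates to the Sobolev inequality. If $\alpha p>s$, then $\theta<1$, the geometric series
converges, and $u$ is bounded and $(\alpha-s/p)$-Hölder on the dense set $\bigcup_j S_j$; it extends
from there.

For compactness, finite mass and lower regularity give total boundedness (`exists_finite_net`). An
Arzelà–Ascoli argument, in which the good sets may depend on the function, yields a subsequence that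
is uniformly Cauchy on them (`exists_subseq_cauchy`). In the Hölder case the good set is all of $X$,
and interpolation lowers the exponent. In the Lebesgue case Borel–Cantelli gives almost everywhere
convergence, and the bound in $L^P$ upgrades it to convergence in $L^r$, $r<P$.

The other two scales reduce to $M^{\alpha,p}$. The $\ell^q$ norm of a fractional gradient is a
gradient, and on a bounded space $N^\alpha_{p,q}$ lies in $M^{\alpha',p}$ for every
$\alpha'<\alpha$; the strict inequalities on $\tilde p$ and $\gamma$ leave room for this loss. -/

/-- `d` is a quasi-metric for which both structural constants can be taken to be `C ≥ 1`. -/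
structure IsQuasiMetricWith (d : X → X → ℝ) (C : ℝ) : Prop where
  nonneg : ∀ x y, 0 ≤ d x y
  eq_zero_iff : ∀ x y, d x y = 0 ↔ x = y
  one_le : 1 ≤ C
  symm : ∀ x y, d y x ≤ C * d x y
  tri : ∀ x y z, d x y ≤ C * max (d x z) (d z y)

theorem IsQuasiMetric.exists_with {d : X → X → ℝ} (hd : IsQuasiMetric d) :
    ∃ C, IsQuasiMetricWith d C := by
  obtain ⟨C₀, h₀, hs⟩ := hd.quasi_symm
  obtain ⟨C₁, h₁, ht⟩ := hd.quasi_triangle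
  refine ⟨max 1 (max C₀ C₁), hd.nonneg, hd.eq_zero_iff, le_max_left _ _, fun x y => ?_,
    fun x y z => ?_⟩
  · exact (hs x y).trans (mul_le_mul_of_nonneg_right
      ((le_max_left _ _).trans (le_max_right _ _)) (hd.nonneg _ _))
  · exact (ht x y z).trans (mul_le_mul_of_nonneg_right
      ((le_max_right _ _).trans (le_max_right _ _)) (le_max_of_le_left (hd.nonneg _ _)))

/-! ### Elementary quasi-metric estimates -/

namespace IsQuasiMetricWith

variable {d : X → X → ℝ} {C : ℝ}

theorem self_eq_zero (hd : IsQuasiMetricWith d C) (x : X) : d x x = 0 :=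
  (hd.eq_zero_iff x x).2 rfl

theorem pos (hd : IsQuasiMetricWith d C) {x y : X} (h : x ≠ y) : 0 < d x y :=
  lt_of_le_of_ne (hd.nonneg x y) fun h' => h ((hd.eq_zero_iff x y).1 h'.symm)

theorem const_pos (hd : IsQuasiMetricWith d C) : 0 < C := one_pos.trans_le hd.one_le

theorem tri_le (hd : IsQuasiMetricWith d C) {x y z : X} {t : ℝ} (h₁ : d x z ≤ t)
    (h₂ : d z y ≤ t) : d x y ≤ C * t :=
  (hd.tri x y z).trans (mul_le_mul_of_nonneg_left (max_le h₁ h₂) hd.const_pos.le)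

/-- Two points `x', y'` close to `x, y` are at distance at most a multiple of `d x y`. -/
theorem four_point (hd : IsQuasiMetricWith d C) {x y x' y' : X} {t : ℝ} (h₁ : d x x' ≤ t)
    (h₂ : d x y ≤ t) (h₃ : d y y' ≤ t) : d x' y' ≤ C ^ 2 * t := by
  have ht : 0 ≤ t := (hd.nonneg _ _).trans h₁
  have hC := hd.one_le
  have a : d x' x ≤ C * t := (hd.symm x x').trans (by gcongr)
  have b : d x y' ≤ C * t := hd.tri_le h₂ h₃
  have c := hd.tri_le a b
  nlinarith

/-! ### Chaining through the level sets -/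

/-- From a point of `S k` a chain with geometrically growing steps leads to a point of `S m`, `m ≤ k`,
with control of the distance and of the oscillation of `u`. -/
theorem exists_chain (hd : IsQuasiMetricWith d C) {S : ℕ → Set X} {u : X → ℝ} {ρ α M Λ : ℝ}
    (hρ : 0 < ρ) (hCρ : C * ρ ≤ 1) (hα : 0 < α) (hM : 1 ≤ M) (hΛ : 0 ≤ Λ) (hmono : Monotone S)
    (hstep : ∀ x j, ∃ y ∈ S j, d x y < ρ ^ j)
    (hosc : ∀ j, ∀ x ∈ S j, ∀ y ∈ S j, |u x - u y| ≤ 2 * Λ * M ^ j * d x y ^ α)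
    {k : ℕ} {x : X} (hx : x ∈ S k) (m : ℕ) (hmk : m ≤ k) :
    ∃ z ∈ S m, d x z ≤ C * ρ ^ m ∧
      |u x - u z| ≤ 2 * Λ * M * ∑ i ∈ Finset.Ico m k, (M * ρ ^ α) ^ i := by
  have hM0 : 0 ≤ M := by linarith
  induction hmk using Nat.decreasingInduction with
  | self =>
    refine ⟨x, hx, ?_, by simp⟩
    rw [hd.self_eq_zero]
    have := hd.const_pos
    positivity
  | of_succ m hm ih =>
    obtain ⟨z, hz, hxz, huz⟩ := ih
    obtain ⟨z', hz', hzz'⟩ := hstep z m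
    refine ⟨z', hz', hd.tri_le (hxz.trans ?_) hzz'.le, ?_⟩
    -- `C * ρ ≤ 1` absorbs the quasi-triangle constant at each step, so it does not accumulate along
    -- the chain.
    · rw [pow_succ]
      have : 0 ≤ ρ ^ m := by positivity
      nlinarith
    -- The two points lie in different levels, so the oscillation is measured in the larger one;
    -- this is the source of the extra factor `M`.
    · have h1 := hosc (m + 1) z hz z' (hmono (Nat.le_succ m) hz')
      have h2 : d z z' ^ α ≤ (ρ ^ α) ^ m := by
        rw [← Real.rpow_natCast, ← Real.rpow_mul hρ.le, mul_comm α, Real.rpow_mul hρ.le,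
          Real.rpow_natCast]
        exact Real.rpow_le_rpow (hd.nonneg _ _) hzz'.le hα.le
      rw [Finset.sum_eq_sum_Ico_succ_bot (by omega)]
      have h3 : |u x - u z'| ≤ |u x - u z| + |u z - u z'| := abs_sub_le _ _ _
      have h4 : 2 * Λ * M ^ (m + 1) * d z z' ^ α ≤ 2 * Λ * M * (M * ρ ^ α) ^ m := by
        calc 2 * Λ * M ^ (m + 1) * d z z' ^ α ≤ 2 * Λ * M ^ (m + 1) * (ρ ^ α) ^ m := by gcongr
          _ = _ := by rw [mul_pow, pow_succ]; ring
      rw [mul_add]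
      linarith

/-- Growth along the level sets in the subcritical range. -/
theorem abs_le_of_one_lt (hd : IsQuasiMetricWith d C) {S : ℕ → Set X} {u : X → ℝ} {ρ α M Λ : ℝ}
    (hρ : 0 < ρ) (hCρ : C * ρ ≤ 1) (hα : 0 < α) (hM : 1 ≤ M) (hΛ : 0 ≤ Λ) (hmono : Monotone S)
    (hstep : ∀ x j, ∃ y ∈ S j, d x y < ρ ^ j)
    (hosc : ∀ j, ∀ x ∈ S j, ∀ y ∈ S j, |u x - u y| ≤ 2 * Λ * M ^ j * d x y ^ α)
    (hzero : ∀ x ∈ S 0, |u x| ≤ Λ) (hθ : 1 < M * ρ ^ α) {k : ℕ} {x : X} (hx : x ∈ S k) :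
    |u x| ≤ (1 + 2 * M / (M * ρ ^ α - 1)) * Λ * (M * ρ ^ α) ^ k := by
  obtain ⟨z, hz, -, h⟩ := hd.exists_chain hρ hCρ hα hM hΛ hmono hstep hosc hx 0 (Nat.zero_le k)
  set θ := M * ρ ^ α
  have h1 : |u x| ≤ |u z| + |u x - u z| := by
    have := abs_add_le (u z) (u x - u z); simpa using this
  have h2 : ∑ i ∈ Finset.Ico 0 k, θ ^ i ≤ θ ^ k / (θ - 1) := by
    rw [← Finset.range_eq_Ico, geom_sum_eq hθ.ne']
    gcongr
    linarith
  have h3 : 2 * Λ * M * ∑ i ∈ Finset.Ico 0 k, θ ^ i ≤ 2 * Λ * M * (θ ^ k / (θ - 1)) := by gcongr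
  have h4 : 1 ≤ θ ^ k := one_le_pow₀ hθ.le
  have h5 := hzero z hz
  have h6 : Λ ≤ Λ * θ ^ k := le_mul_of_one_le_right hΛ h4
  calc |u x| ≤ Λ * θ ^ k + 2 * Λ * M * (θ ^ k / (θ - 1)) := by linarith
    _ = _ := by ring

theorem sum_Ico_pow_le {θ : ℝ} (h0 : 0 ≤ θ) (h1 : θ < 1) (m k : ℕ) :
    ∑ i ∈ Finset.Ico m k, θ ^ i ≤ θ ^ m / (1 - θ) := by
  rw [Finset.sum_Ico_eq_sum_range]
  simp_rw [pow_add]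
  rw [← Finset.mul_sum, div_eq_mul_inv]
  gcongr
  rw [← tsum_geometric_of_lt_one h0 h1]
  exact (summable_geometric_of_lt_one h0 h1).sum_le_tsum _ fun i _ => by positivity

/-- Boundedness on the level sets in the supercritical range. -/
theorem abs_le_of_lt_one (hd : IsQuasiMetricWith d C) {S : ℕ → Set X} {u : X → ℝ} {ρ α M Λ : ℝ}
    (hρ : 0 < ρ) (hCρ : C * ρ ≤ 1) (hα : 0 < α) (hM : 1 ≤ M) (hΛ : 0 ≤ Λ) (hmono : Monotone S)
    (hstep : ∀ x j, ∃ y ∈ S j, d x y < ρ ^ j)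
    (hosc : ∀ j, ∀ x ∈ S j, ∀ y ∈ S j, |u x - u y| ≤ 2 * Λ * M ^ j * d x y ^ α)
    (hzero : ∀ x ∈ S 0, |u x| ≤ Λ) (hθ : M * ρ ^ α < 1) {k : ℕ} {x : X} (hx : x ∈ S k) :
    |u x| ≤ (1 + 2 * M / (1 - M * ρ ^ α)) * Λ := by
  obtain ⟨z, hz, -, h⟩ := hd.exists_chain hρ hCρ hα hM hΛ hmono hstep hosc hx 0 (Nat.zero_le k)
  have hθ0 : 0 ≤ M * ρ ^ α := by positivity
  have h2 := sum_Ico_pow_le hθ0 hθ 0 k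
  set θ := M * ρ ^ α
  have h1 : |u x| ≤ |u z| + |u x - u z| := by
    have := abs_add_le (u z) (u x - u z); simpa using this
  have h3 : 2 * Λ * M * ∑ i ∈ Finset.Ico 0 k, θ ^ i ≤ 2 * Λ * M * (θ ^ 0 / (1 - θ)) := by gcongr
  have h5 := hzero z hz
  calc |u x| ≤ Λ + 2 * Λ * M * (θ ^ 0 / (1 - θ)) := by linarith
    _ = _ := by ring

/-- Hölder continuity on the level sets in the supercritical range. -/
theorem abs_sub_le_of_lt_one (hd : IsQuasiMetricWith d C) {S : ℕ → Set X} {u : X → ℝ}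
    {ρ α β M Λ : ℝ} (hρ : 0 < ρ) (hρ1 : ρ < 1) (hCρ : C * ρ ≤ 1) (hα : 0 < α) (hM : 1 ≤ M)
    (hΛ : 0 ≤ Λ) (hmono : Monotone S)
    (hstep : ∀ x j, ∃ y ∈ S j, d x y < ρ ^ j)
    (hosc : ∀ j, ∀ x ∈ S j, ∀ y ∈ S j, |u x - u y| ≤ 2 * Λ * M ^ j * d x y ^ α)
    (hβ : 0 < β) (hθ : M * ρ ^ α < 1) (hρβ : ρ ^ β = M * ρ ^ α)
    {k : ℕ} {x y : X} (hx : x ∈ S k) (hy : y ∈ S k) (hxy : 0 < d x y) (hxy1 : d x y ≤ 1) :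
    |u x - u y| ≤ (4 * M / (1 - M * ρ ^ α) + 2 * (C ^ 3) ^ α) / (M * ρ ^ α) * Λ * d x y ^ β := by
  -- `m` is the scale of the pair: `ρ ^ (m + 1) < d x y ≤ ρ ^ m`. Both points descend to level `m`
  -- and are compared there.
  obtain ⟨m, hm1, hm2⟩ := exists_nat_pow_near_of_lt_one hxy hxy1 hρ hρ1
  -- Starting at `max m k` also covers `k < m`, where the points already lie in `S m`.
  have hxk : x ∈ S (max m k) := hmono (le_max_right m k) hx
  have hyk : y ∈ S (max m k) := hmono (le_max_right m k) hy
  obtain ⟨x', hx', hxx', hux⟩ :=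
    hd.exists_chain hρ hCρ hα hM hΛ hmono hstep hosc hxk m (le_max_left m k)
  obtain ⟨y', hy', hyy', huy⟩ :=
    hd.exists_chain hρ hCρ hα hM hΛ hmono hstep hosc hyk m (le_max_left m k)
  have hθ0 : 0 < M * ρ ^ α := by positivity
  have hsum := sum_Ico_pow_le hθ0.le hθ m (max m k)
  have hC := hd.one_le
  have hd' : d x' y' ≤ C ^ 3 * ρ ^ m := by
    have := hd.four_point hxx' (hm2.trans (le_mul_of_one_le_left (by positivity) hC)) hyy'
    calc _ ≤ _ := this
      _ = _ := by ring
  have hα' : d x' y' ^ α ≤ (C ^ 3) ^ α * (ρ ^ α) ^ m := by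
    calc d x' y' ^ α ≤ (C ^ 3 * ρ ^ m) ^ α := Real.rpow_le_rpow (hd.nonneg _ _) hd' hα.le
      _ = (C ^ 3) ^ α * (ρ ^ α) ^ m := by
        rw [Real.mul_rpow (by positivity) (by positivity), ← Real.rpow_natCast (ρ ^ α),
          ← Real.rpow_mul hρ.le, mul_comm α, Real.rpow_mul hρ.le, Real.rpow_natCast]
  have hosc' : |u x' - u y'| ≤ 2 * (C ^ 3) ^ α * Λ * (M * ρ ^ α) ^ m := by
    calc |u x' - u y'| ≤ 2 * Λ * M ^ m * d x' y' ^ α := hosc m _ hx' _ hy'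
      _ ≤ 2 * Λ * M ^ m * ((C ^ 3) ^ α * (ρ ^ α) ^ m) := by gcongr
      _ = _ := by rw [mul_pow]; ring
  -- Since `ρ ^ β = M * ρ ^ α`, the bound `ρ ^ (m + 1) < d x y` becomes this one; the spare factor
  -- is the denominator in the Hölder constant.
  have hlow : (M * ρ ^ α) ^ m * (M * ρ ^ α) ≤ d x y ^ β := by
    rw [← pow_succ, ← hρβ, ← Real.rpow_natCast (ρ ^ β), ← Real.rpow_mul hρ.le, mul_comm β,
      Real.rpow_mul hρ.le, Real.rpow_natCast]
    exact Real.rpow_le_rpow (by positivity) hm1.le hβ.le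
  set θ := M * ρ ^ α
  have htri : |u x - u y| ≤ |u x - u x'| + |u x' - u y'| + |u y - u y'| := by
    have e : u x - u y = (u x - u x') + (u x' - u y') + -(u y - u y') := by ring
    rw [e]
    refine (abs_add_le _ _).trans ?_
    rw [abs_neg]
    gcongr
    exact abs_add_le _ _
  have h3 : 2 * Λ * M * ∑ i ∈ Finset.Ico m (max m k), θ ^ i ≤ 2 * Λ * M * (θ ^ m / (1 - θ)) := by
    gcongr
  have h1θ : 0 < 1 - θ := by linarith
  calc |u x - u y| ≤ (4 * M / (1 - θ) + 2 * (C ^ 3) ^ α) * Λ * θ ^ m := by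
        have e : (4 * M / (1 - θ) + 2 * (C ^ 3) ^ α) * Λ * θ ^ m
          = 2 * (2 * Λ * M * (θ ^ m / (1 - θ))) + 2 * (C ^ 3) ^ α * Λ * θ ^ m := by ring
        rw [e]; linarith
    _ = (4 * M / (1 - θ) + 2 * (C ^ 3) ^ α) / θ * Λ * (θ ^ m * θ) := by field_simp
    _ ≤ _ := by gcongr

/-! ### Extension from dense sets and an Arzelà–Ascoli argument -/

/-- A Hölder continuous bounded function on a dense set extends to the whole space. -/
theorem exists_holder_extension (hd : IsQuasiMetricWith d C) {S : Set X} {u : X → ℝ} {β H B : ℝ}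
    (hβ : 0 < β) (hH : 0 ≤ H) (hdense : ∀ x, ∀ ε : ℝ, 0 < ε → ∃ y ∈ S, d x y < ε)
    (hu : ∀ x ∈ S, ∀ y ∈ S, |u x - u y| ≤ H * d x y ^ β) (hB : ∀ x ∈ S, |u x| ≤ B) :
    ∃ v : X → ℝ, (∀ x ∈ S, v x = u x) ∧ (∀ x, |v x| ≤ B) ∧
      ∀ x y, |v x - v y| ≤ H * (C ^ 2) ^ β * d x y ^ β := by
  have hC := hd.one_le
  have hpos : ∀ n : ℕ, 0 < 1 / ((n : ℝ) + 1) := fun n => by positivity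
  choose z hzS hz using fun (x : X) (n : ℕ) => hdense x (1 / ((n : ℝ) + 1)) (hpos n)
  have hlim0 : Tendsto (fun t : ℝ => H * (C ^ 2 * t) ^ β) (𝓝 0) (𝓝 0) := by
    have h : Continuous fun t : ℝ => H * (C ^ 2 * t) ^ β :=
      continuous_const.mul ((continuous_const.mul continuous_id).rpow_const fun _ => Or.inr hβ.le)
    simpa [Real.zero_rpow hβ.ne'] using h.tendsto 0
  have hlim : Tendsto (fun n : ℕ => H * (C ^ 2 * (1 / ((n : ℝ) + 1))) ^ β) atTop (𝓝 0) :=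
    hlim0.comp tendsto_one_div_add_atTop_nhds_zero_nat
  have hmono : ∀ {N n : ℕ}, N ≤ n → 1 / ((n : ℝ) + 1) ≤ 1 / ((N : ℝ) + 1) := fun h =>
    Nat.one_div_le_one_div h
  have hcau : ∀ x, CauchySeq fun n => u (z x n) := fun x => by
    refine cauchySeq_of_le_tendsto_0 _ (fun n m N hn hm => ?_) hlim
    rw [Real.dist_eq]
    refine (hu _ (hzS x n) _ (hzS x m)).trans ?_
    gcongr
    · exact hd.nonneg _ _
    · exact hd.four_point ((hz x n).le.trans (hmono hn)) (by rw [hd.self_eq_zero]; exact (hpos N).le)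
        ((hz x m).le.trans (hmono hm))
  choose v hv using fun x => cauchySeq_tendsto_of_complete (hcau x)
  refine ⟨v, fun x hx => ?_, fun x => ?_, fun x y => ?_⟩
  · refine tendsto_nhds_unique (hv x) ?_
    rw [tendsto_iff_dist_tendsto_zero]
    refine squeeze_zero (fun _ => dist_nonneg) (fun n => ?_) hlim
    rw [dist_comm, Real.dist_eq]
    refine (hu _ hx _ (hzS x n)).trans ?_
    gcongr
    · exact hd.nonneg _ _
    · refine (hz x n).le.trans (le_mul_of_one_le_left (hpos n).le (one_le_pow₀ hC))
  · exact le_of_tendsto (hv x).abs (Eventually.of_forall fun n => hB _ (hzS x n))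
  · rcases eq_or_ne x y with rfl | hxy
    · simp only [sub_self, abs_zero]
      have := Real.rpow_nonneg (hd.nonneg x x) β
      positivity
    · have hev : ∀ᶠ n : ℕ in atTop, 1 / ((n : ℝ) + 1) < d x y :=
        tendsto_one_div_add_atTop_nhds_zero_nat.eventually_lt_const (hd.pos hxy)
      refine le_of_tendsto ((hv x).sub (hv y)).abs (hev.mono fun n hn => ?_)
      refine (hu _ (hzS x n) _ (hzS y n)).trans ?_
      rw [mul_assoc, ← Real.mul_rpow (by positivity) (hd.nonneg _ _)]
      gcongr
      · exact hd.nonneg _ _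
      · exact hd.four_point ((hz x n).le.trans hn.le) le_rfl ((hz y n).le.trans hn.le)

/-- A sequence of functions that are uniformly Hölder and bounded on large sets has a subsequence
that is uniformly Cauchy on them. -/
theorem exists_subseq_cauchy (hd : IsQuasiMetricWith d C)
    (htb : ∀ ε : ℝ, 0 < ε → ∃ F : Finset X, ∀ x, ∃ z ∈ F, d x z < ε) {α : ℝ} (hα : 0 < α)
    (u : ℕ → X → ℝ) (G : ℕ → ℕ → Set X) (K : ℕ → ℝ)
    (hosc : ∀ j n, ∀ x ∈ G j n, ∀ y ∈ G j n, |u n x - u n y| ≤ K j * d x y ^ α)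
    (hbd : ∀ j n, ∀ x ∈ G j n, |u n x| ≤ K j) :
    ∃ φ : ℕ → ℕ, StrictMono φ ∧ ∀ j n m, j ≤ n → j ≤ m → ∀ x ∈ G j (φ n) ∩ G j (φ m),
      |u (φ n) x - u (φ m) x| ≤ (1 / 2) ^ j := by
  classical
  have hC := hd.one_le
  -- Points with a common net point are at distance at most `C ^ 2 * δ`, so on a cell within a good
  -- set each function oscillates by at most a third of the tolerance.
  have hδ : ∀ j, ∃ δ : ℝ, 0 < δ ∧ |K j| * (C ^ 2 * δ) ^ α ≤ (1 / 2) ^ j / 3 := fun j => by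
    have h : Continuous fun t : ℝ => |K j| * (C ^ 2 * t) ^ α :=
      continuous_const.mul ((continuous_const.mul continuous_id).rpow_const fun _ => Or.inr hα.le)
    have h0 : Tendsto (fun t : ℝ => |K j| * (C ^ 2 * t) ^ α) (𝓝[>] 0) (𝓝 0) := by
      have := h.tendsto 0
      simp only [mul_zero, Real.zero_rpow hα.ne'] at this
      exact this.mono_left nhdsWithin_le_nhds
    have h1 := h0.eventually_le_const (show (0 : ℝ) < (1 / 2) ^ j / 3 by positivity)
    obtain ⟨δ, hδ1, hδ2⟩ := (h1.and self_mem_nhdsWithin).exists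
    exact ⟨δ, hδ2, hδ1⟩
  choose δ hδ0 hδ using hδ
  choose F hF using fun j => htb (δ j) (hδ0 j)
  choose ν hνF hν using hF
  -- Each function is encoded by one number per cell, its value at some good point of the cell, or
  -- `0` if there is none. The good sets vary with `n`, but the cells do not.
  have hc : ∀ (n : ℕ) (i : Σ j, F j), ∃ c ∈ Set.Icc (-|K i.1|) |K i.1|,
      ∀ x ∈ G i.1 n, ν i.1 x = i.2 → |u n x - c| ≤ (1 / 2) ^ i.1 / 3 := fun n i => by
    by_cases hex : ∃ y ∈ G i.1 n, ν i.1 y = i.2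
    · obtain ⟨y, hy, hyν⟩ := hex
      refine ⟨u n y, abs_le.1 ((hbd _ _ _ hy).trans (le_abs_self _)), fun x hx hxν => ?_⟩
      refine (hosc _ _ x hx y hy).trans (le_trans ?_ (hδ i.1))
      have h1 : d (ν i.1 x) x ≤ C * δ i.1 := (hd.symm _ _).trans (by
        have := (hν i.1 x).le; gcongr)
      have hxy : d x y ≤ C ^ 2 * δ i.1 := by
        have h2 : d (ν i.1 x) y ≤ C * δ i.1 := by
          rw [hxν, ← hyν]; exact (hd.symm _ _).trans (by have := (hν i.1 y).le; gcongr)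
        have h3 : d x (ν i.1 x) ≤ C * δ i.1 :=
          (hν i.1 x).le.trans (le_mul_of_one_le_left (hδ0 _).le hC)
        calc _ ≤ _ := hd.tri_le h3 h2
          _ = _ := by ring
      gcongr
      · exact Real.rpow_nonneg (hd.nonneg _ _) _
      · exact le_abs_self _
      · exact hd.nonneg _ _
    · refine ⟨0, by simp, fun x hx hxν => (hex ⟨x, hx, hxν⟩).elim⟩
  choose c hcK hc using hc
  -- There are countably many cells in all, so the product of intervals is sequentially compact and
  -- one subsequence serves every scale.
  obtain ⟨a, -, φ, hφ, hlim⟩ := (isCompact_univ_pi fun i : Σ j, F j =>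
    (isCompact_Icc : IsCompact (Set.Icc (-|K i.1|) |K i.1|))).tendsto_subseq
      (x := c) fun n i _ => hcK n i
  rw [tendsto_pi_nhds] at hlim
  -- The final error is `1/3 + 1/6 + 1/6 + 1/3` of the tolerance.
  have hev : ∀ j, ∀ᶠ N in atTop, ∀ n ≥ N, ∀ z : F j, |c (φ n) ⟨j, z⟩ - a ⟨j, z⟩| ≤ (1 / 2) ^ j / 6 :=
    fun j => by
      refine eventually_forall_ge_atTop.2 (eventually_all.2 fun z => ?_)
      have := (tendsto_iff_dist_tendsto_zero.1 (hlim ⟨j, z⟩)).eventually_le_const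
        (show (0 : ℝ) < (1 / 2) ^ j / 6 by positivity)
      simpa only [Real.dist_eq, Function.comp_apply] using this
  obtain ⟨ψ, hψ, hψP⟩ := extraction_forall_of_eventually hev
  refine ⟨φ ∘ ψ, hφ.comp hψ, fun j n m hn hm x hx => ?_⟩
  have a1 := hψP j (ψ n) (hψ.monotone hn) ⟨ν j x, hνF j x⟩
  have a2 := hψP j (ψ m) (hψ.monotone hm) ⟨ν j x, hνF j x⟩
  have a3 := hc (φ (ψ n)) ⟨j, ⟨ν j x, hνF j x⟩⟩ x hx.1 rfl
  have a4 := hc (φ (ψ m)) ⟨j, ⟨ν j x, hνF j x⟩⟩ x hx.2 rfl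
  simp only [Function.comp_apply] at *
  rw [abs_le] at *
  constructor <;> linarith [a1.1, a1.2, a2.1, a2.2, a3.1, a3.2, a4.1, a4.2]

end IsQuasiMetricWith

/-! ### Total boundedness, admissible functions and their level sets -/

/-- A totally bounded quasi-metric space is bounded. -/
theorem exists_dist_lt {d : X → X → ℝ} {C : ℝ} (hd : IsQuasiMetricWith d C)
    (htb : ∀ ε : ℝ, 0 < ε → ∃ F : Finset X, ∀ x, ∃ z ∈ F, d x z < ε) :
    ∃ D : ℝ, ∀ x y, d x y < D := by
  obtain ⟨F, hF⟩ := htb 1 one_pos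
  have hC := hd.one_le
  obtain ⟨T, hT⟩ := ((F ×ˢ F).image fun z => d z.1 z.2).bddAbove
  have hT' : ∀ z ∈ F, ∀ w ∈ F, d z w ≤ T := fun z hz w hw =>
    hT (Finset.mem_coe.2 (Finset.mem_image.2 ⟨(z, w), Finset.mem_product.2 ⟨hz, hw⟩, rfl⟩))
  refine ⟨C * (C * max T C) + 1, fun x y => ?_⟩
  obtain ⟨z, hz, hxz⟩ := hF x
  obtain ⟨w, hw, hyw⟩ := hF y
  have h1 : d w y ≤ max T C := (hd.symm y w).trans
    ((mul_le_of_le_one_right hd.const_pos.le hyw.le).trans (le_max_right _ _))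
  have h2 := hd.tri_le ((hT' z hz w hw).trans (le_max_left _ C)) h1
  have h3 : (1 : ℝ) ≤ C * max T C := by
    have : C ≤ max T C := le_max_right _ _
    nlinarith
  linarith [hd.tri_le (hxz.le.trans h3) h2]

theorem holderNorm_le {d : X → X → ℝ} {C : ℝ} (hd : IsQuasiMetricWith d C) {β A B : ℝ} (hA : 0 ≤ A) (hB : 0 ≤ B)
    {v : X → ℝ} (hvA : ∀ x, |v x| ≤ A) (hvB : ∀ x y, |v x - v y| ≤ B * d x y ^ β) :
    holderNorm d β v ≤ ENNReal.ofReal (A + B) := by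
  rw [holderNorm, ENNReal.ofReal_add hA hB]
  refine add_le_add (iSup_le fun x => ENNReal.ofReal_le_ofReal (hvA x))
    (iSup_le fun x => iSup_le fun y => iSup_le fun hxy => ENNReal.ofReal_le_ofReal ?_)
  rw [div_le_iff₀ (Real.rpow_pos_of_pos (hd.pos hxy) β)]
  exact hvB x y

section

variable [MeasurableSpace X] {d : X → X → ℝ} {μ : Measure X} {C s : ℝ}

/-- A finite lower regular space is totally bounded. -/
theorem exists_finite_net (hd : IsQuasiMetricWith d C) (hX : IsQuasiMetricMeasureSpace d μ)
    (hμ : μ Set.univ < ∞) (hreg : IsLocallyLowerAhlforsRegular d μ s) (ε : ℝ) (hε : 0 < ε) :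
    ∃ F : Finset X, ∀ x, ∃ z ∈ F, d x z < ε := by
  classical
  obtain ⟨b, hb, hball⟩ := hreg
  have hC := hd.one_le
  obtain ⟨r, hr0, hr1, hrε⟩ : ∃ r : ℝ, 0 < r ∧ r ≤ 1 ∧ C * (C * r) < ε := by
    refine ⟨min 1 (ε / (2 * (C * C))), by positivity, min_le_left _ _, ?_⟩
    have : min 1 (ε / (2 * (C * C))) ≤ ε / (2 * (C * C)) := min_le_right _ _
    calc C * (C * min 1 (ε / (2 * (C * C)))) ≤ C * (C * (ε / (2 * (C * C)))) := by gcongr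
      _ = ε / 2 := by field_simp
      _ < ε := by linarith
  by_contra! hcon
  -- Without a finite `ε`-net, points can be added forever; as `C * (C * r) < ε`, their `r`-balls
  -- are disjoint, and each has mass at least `b * r ^ s`.
  have hdisj : ∀ n : ℕ, ∃ F : Finset X, F.card = n ∧
      (F : Set X).PairwiseDisjoint fun x => qball d x r := by
    intro n
    induction n with
    | zero => exact ⟨∅, by simp, by simp⟩
    | succ n ih =>
      obtain ⟨F, hFn, hF⟩ := ih
      obtain ⟨x, hx⟩ := hcon F
      have hxF : x ∉ F := fun h => by
        have := hx x h; rw [hd.self_eq_zero] at this; linarith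
      refine ⟨insert x F, by rw [Finset.card_insert_of_notMem hxF, hFn], ?_⟩
      rw [Finset.coe_insert]
      refine hF.insert fun z hz _ => Set.disjoint_left.2 fun y hy hy' => ?_
      have h1 : d y z ≤ C * r := (hd.symm z y).trans (by
        have : d z y < r := hy'
        gcongr)
      have h2 : d x y < r := hy
      have h3 := hd.tri_le (h2.le.trans (le_mul_of_one_le_left hr0.le hC)) h1
      linarith [hx z hz]
  have hc : 0 < b * r ^ s := mul_pos hb (Real.rpow_pos_of_pos hr0 s)
  have hbound : ∀ n : ℕ, (n : ℝ≥0∞) * ENNReal.ofReal (b * r ^ s) ≤ μ Set.univ := fun n => by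
    obtain ⟨F, hFn, hF⟩ := hdisj n
    calc (n : ℝ≥0∞) * ENNReal.ofReal (b * r ^ s)
        = ∑ x ∈ F, ENNReal.ofReal (b * r ^ s) := by simp [hFn]
      _ ≤ ∑ x ∈ F, μ (qball d x r) := Finset.sum_le_sum fun x _ => hball x r hr0 hr1
      _ = μ (⋃ x ∈ F, qball d x r) :=
        (measure_biUnion_finset hF fun x _ => hX.measurableSet_qball x r hr0).symm
      _ ≤ μ Set.univ := measure_mono (Set.subset_univ _)
  have hc' : ENNReal.ofReal (b * r ^ s) ≠ 0 := by simpa using hc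
  obtain ⟨n, hn⟩ := ENNReal.exists_nat_mul_gt hc' hμ.ne
  exact absurd (hbound n) (not_le.2 hn)

/-- The level sets of an admissible function meet all balls of the corresponding radius. -/
theorem exists_mem_level {b p M Λ : ℝ} (hb : 0 < b) (hs : 0 < s) (hp : 0 < p) (hM : 1 ≤ M)
    (hΛ : 0 < Λ)
    (hball : ∀ (x : X) (r : ℝ), 0 < r → r ≤ 1 → ENNReal.ofReal (b * r ^ s) ≤ μ (qball d x r))
    {h : X → ℝ≥0∞} (hh : Measurable h) {E : Set X} (hE : μ E = 0)
    (hint : ∫⁻ x, h x ^ p ∂μ ≤ ENNReal.ofReal (Λ ^ p * (b / 2))) (x : X) (j : ℕ) :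
    ∃ y ∈ {y | y ∉ E ∧ h y ≤ ENNReal.ofReal (Λ * M ^ j)}, d x y < (M ^ (-(p / s))) ^ j := by
  have hM0 : 0 < M := by linarith
  have hMj : 0 < M ^ j := by positivity
  set r : ℝ := (M ^ (-(p / s))) ^ j with hr
  have hr0 : 0 < r := by positivity
  have hr1 : r ≤ 1 := pow_le_one₀ (by positivity)
    (Real.rpow_le_one_of_one_le_of_nonpos hM (by rw [neg_nonpos]; positivity))
  have hrs : r ^ s = ((M ^ j) ^ p)⁻¹ := by
    rw [hr, ← Real.rpow_natCast, ← Real.rpow_mul hM0.le, ← Real.rpow_mul hM0.le,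
      ← Real.rpow_natCast, ← Real.rpow_mul hM0.le, ← Real.rpow_neg hM0.le]
    congr 1; field_simp
  -- The factor `b / 2` in the moment bound makes the Chebyshev estimate strictly smaller than the
  -- mass of the ball. Including `E` lets the point found avoid it.
  have hlt : μ (E ∪ {y | ENNReal.ofReal (Λ * M ^ j) ^ p ≤ h y ^ p}) < μ (qball d x r) := by
    calc μ (E ∪ {y | ENNReal.ofReal (Λ * M ^ j) ^ p ≤ h y ^ p})
        ≤ μ E + μ {y | ENNReal.ofReal (Λ * M ^ j) ^ p ≤ h y ^ p} := measure_union_le _ _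
      _ = μ {y | ENNReal.ofReal (Λ * M ^ j) ^ p ≤ h y ^ p} := by rw [hE, zero_add]
      _ ≤ (∫⁻ y, h y ^ p ∂μ) / ENNReal.ofReal (Λ * M ^ j) ^ p := by
        have hpos : 0 < ENNReal.ofReal (Λ * M ^ j) := by simp; positivity
        refine meas_ge_le_lintegral_div (hh.pow_const p).aemeasurable ?_ ?_
        · exact (ENNReal.rpow_pos hpos ENNReal.ofReal_ne_top).ne'
        · exact ENNReal.rpow_ne_top_of_nonneg hp.le ENNReal.ofReal_ne_top
      _ ≤ ENNReal.ofReal (Λ ^ p * (b / 2)) / ENNReal.ofReal (Λ * M ^ j) ^ p := by gcongr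
      _ = ENNReal.ofReal (b / 2 * r ^ s) := by
        rw [ENNReal.ofReal_rpow_of_pos (by positivity), ← ENNReal.ofReal_div_of_pos (by positivity),
          Real.mul_rpow hΛ.le hMj.le, hrs]
        congr 1
        have : (0 : ℝ) < Λ ^ p := by positivity
        field_simp
      _ < ENNReal.ofReal (b * r ^ s) := by
        have : 0 < r ^ s := by positivity
        exact (ENNReal.ofReal_lt_ofReal_iff (by positivity)).2 (by nlinarith)
      _ ≤ μ (qball d x r) := hball x r hr0 hr1
  obtain ⟨y, hy, hy'⟩ := Set.not_subset.1 fun hsub => (measure_mono hsub).not_gt hlt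
  simp only [Set.mem_union, not_or, Set.mem_ofPred_eq, not_le] at hy'
  exact ⟨y, ⟨hy'.1, ((ENNReal.rpow_lt_rpow_iff hp).1 hy'.2).le⟩, hy⟩

/-- A function `h` dominating `|u|` and a gradient of `u`, off a null set. -/
structure Admissible (d : X → X → ℝ) (μ : Measure X) (α : ℝ) (u : X → ℝ) (h : X → ℝ≥0∞)
    (E : Set X) : Prop where
  measurable : Measurable h
  measure_zero : μ E = 0
  grad : ∀ x y, x ∉ E → y ∉ E →
    ENNReal.ofReal |u x - u y| ≤ ENNReal.ofReal (d x y ^ α) * (h x + h y)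
  abs_le : ∀ x, ENNReal.ofReal |u x| ≤ h x

/-- Both values of `h` in the gradient inequality are at most `t`; this supplies the oscillation
hypothesis of the chaining and compactness lemmas. -/
theorem Admissible.abs_sub_le {α : ℝ} {u : X → ℝ} {h : X → ℝ≥0∞} {E : Set X}
    (H : Admissible d μ α u h E) (hd : ∀ x y, 0 ≤ d x y) {t : ℝ} (ht : 0 ≤ t) {x y : X}
    (hx : x ∉ E ∧ h x ≤ ENNReal.ofReal t) (hy : y ∉ E ∧ h y ≤ ENNReal.ofReal t) :
    |u x - u y| ≤ 2 * t * d x y ^ α := by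
  have hdα : 0 ≤ d x y ^ α := Real.rpow_nonneg (hd x y) α
  rw [← ENNReal.ofReal_le_ofReal_iff (by positivity)]
  calc _ ≤ _ := H.grad x y hx.1 hy.1
    _ ≤ ENNReal.ofReal (d x y ^ α) * (ENNReal.ofReal t + ENNReal.ofReal t) := by
      gcongr
      exacts [hx.2, hy.2]
    _ = _ := by
      rw [← ENNReal.ofReal_add ht ht, ← ENNReal.ofReal_mul hdα]
      congr 1; ring

theorem Admissible.abs_le_real {α : ℝ} {u : X → ℝ} {h : X → ℝ≥0∞} {E : Set X}
    (H : Admissible d μ α u h E) {t : ℝ} (ht : 0 ≤ t) {x : X}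
    (hx : h x ≤ ENNReal.ofReal t) : |u x| ≤ t :=
  (ENNReal.ofReal_le_ofReal_iff ht).1 ((H.abs_le x).trans hx)

theorem lintegral_rpow_of_eLpNorm_le {ε : Type*} [ENorm ε] {g : X → ε} {p : ℝ} (hp : 0 < p)
    {T : ℝ≥0∞} (hg : eLpNorm g (ENNReal.ofReal p) μ ≤ T) : ∫⁻ x, ‖g x‖ₑ ^ p ∂μ ≤ T ^ p := by
  rw [eLpNorm_eq_lintegral_rpow_enorm_toReal (by simpa using hp) ENNReal.ofReal_ne_top,
    ENNReal.toReal_ofReal hp.le] at hg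
  have := ENNReal.rpow_le_rpow hg hp.le
  rwa [← ENNReal.rpow_mul, one_div, inv_mul_cancel₀ hp.ne', ENNReal.rpow_one] at this

theorem eLpNorm_le_of_lintegral_rpow {ε : Type*} [ENorm ε] {g : X → ε} {p : ℝ} (hp : 0 < p)
    {T : ℝ≥0∞} (hg : ∫⁻ x, ‖g x‖ₑ ^ p ∂μ ≤ T ^ p) : eLpNorm g (ENNReal.ofReal p) μ ≤ T := by
  rw [eLpNorm_eq_lintegral_rpow_enorm_toReal (by simpa using hp) ENNReal.ofReal_ne_top,
    ENNReal.toReal_ofReal hp.le]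
  have := ENNReal.rpow_le_rpow hg (one_div_nonneg.2 hp.le)
  rwa [← ENNReal.rpow_mul, mul_one_div_cancel hp.ne', ENNReal.rpow_one] at this

/-- Functions of norm at most `T` have admissible functions with controlled `p`-th moment. -/
theorem exists_admissible {α p : ℝ} (hp : 0 < p) {u : X → ℝ}
    (hu : u ∈ (hajlaszSobolev d μ α (ENNReal.ofReal p)).carrier) {T : ℝ} (hT : 0 < T)
    (hnorm : (hajlaszSobolev d μ α (ENNReal.ofReal p)).norm u ≤ ENNReal.ofReal T) :
    ∃ (h : X → ℝ≥0∞) (E : Set X), Admissible d μ α u h E ∧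
      ∫⁻ x, h x ^ p ∂μ ≤ ENNReal.ofReal (2 * (2 * T) ^ p) := by
  -- Doubling `T` makes the inequality strict, so a gradient exists below the bound even if the
  -- infimum is not attained.
  have hlt : ENNReal.ofReal T < ENNReal.ofReal (2 * T) :=
    (ENNReal.ofReal_lt_ofReal_iff (by linarith)).2 (by linarith)
  have h1 : eLpNorm u (ENNReal.ofReal p) μ ≤ ENNReal.ofReal (2 * T) :=
    (le_self_add.trans hnorm).trans hlt.le
  have h2 : hajlaszSobolevSeminorm d μ α (ENNReal.ofReal p) u < ENNReal.ofReal (2 * T) :=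
    (le_add_self.trans hnorm).trans_lt hlt
  simp only [hajlaszSobolevSeminorm, iInf_lt_iff] at h2
  obtain ⟨g, ⟨hgm, E, -, hE0, hE⟩, hg⟩ := h2
  have hum : Measurable fun x => ENNReal.ofReal |u x| :=
    (measurable_norm.comp hu.1).ennreal_ofReal
  refine ⟨fun x => max (ENNReal.ofReal |u x|) (g x), E, ⟨hum.max hgm, hE0,
    fun x y hx hy => ?_, fun x => le_max_left _ _⟩, ?_⟩
  · refine (hE x y hx hy).trans ?_
    gcongr <;> exact le_max_right _ _
  · have i1 := lintegral_rpow_of_eLpNorm_le hp h1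
    have i2 := lintegral_rpow_of_eLpNorm_le hp hg.le
    calc ∫⁻ x, max (ENNReal.ofReal |u x|) (g x) ^ p ∂μ
        ≤ ∫⁻ x, (‖u x‖ₑ ^ p + ‖g x‖ₑ ^ p) ∂μ := by
          refine lintegral_mono fun x => ?_
          rcases le_total (ENNReal.ofReal |u x|) (g x) with hx | hx
          · simp only [max_eq_right hx, enorm_eq_self]
            exact le_add_self
          · simp only [max_eq_left hx, Real.enorm_eq_ofReal_abs]
            exact le_self_add
      _ = (∫⁻ x, ‖u x‖ₑ ^ p ∂μ) + ∫⁻ x, ‖g x‖ₑ ^ p ∂μ :=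
        lintegral_add_right _ (hgm.enorm.pow_const p)
      _ ≤ ENNReal.ofReal (2 * T) ^ p + ENNReal.ofReal (2 * T) ^ p := add_le_add i1 i2
      _ = _ := by
        rw [← two_mul, ENNReal.ofReal_rpow_of_pos (by linarith), ENNReal.ofReal_mul zero_le_two]
        simp

/-- To embed continuously it suffices to bound functions by arbitrary upper bounds of their norm. -/
theorem embedsContinuously_of_forall {α p : ℝ} (hp : 0 < p) {B : FunctionSpace X}
    (h0 : (0 : X → ℝ) ∈ B.carrier) (hB0 : B.norm 0 = 0) (K : ℝ≥0)
    (h : ∀ u ∈ (hajlaszSobolev d μ α (ENNReal.ofReal p)).carrier, ∀ T : ℝ, 0 < T →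
      (hajlaszSobolev d μ α (ENNReal.ofReal p)).norm u ≤ ENNReal.ofReal T →
      ∃ v ∈ B.carrier, v =ᵐ[μ] u ∧ B.norm v ≤ K * ENNReal.ofReal T) :
    EmbedsContinuously μ (hajlaszSobolev d μ α (ENNReal.ofReal p)) B := by
  refine ⟨K, fun u hu => ?_⟩
  have hfin : (hajlaszSobolev d μ α (ENNReal.ofReal p)).norm u ≠ ∞ :=
    ENNReal.add_ne_top.2 ⟨hu.2.1.2.ne, hu.2.2.ne⟩
  -- A vanishing norm is not itself an admissible positive bound `T`; there `u = 0` almost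
  -- everywhere and `0` represents it.
  rcases eq_or_ne ((hajlaszSobolev d μ α (ENNReal.ofReal p)).norm u) 0 with hz | hz
  · have hu0 : eLpNorm u (ENNReal.ofReal p) μ = 0 := (add_eq_zero.1 hz).1
    rw [eLpNorm_eq_zero_iff hu.2.1.1 (by simpa using hp)] at hu0
    exact ⟨0, h0, hu0.symm, by rw [hB0]; exact zero_le⟩
  · obtain ⟨v, hv, hvu, hvn⟩ := h u hu _ (ENNReal.toReal_pos hz hfin)
      (ENNReal.ofReal_toReal hfin).ge
    exact ⟨v, hv, hvu, by rwa [ENNReal.ofReal_toReal hfin] at hvn⟩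

end

/-! ### Choice of parameters and the continuous embeddings -/

theorem monotone_level {h : X → ℝ≥0∞} {E : Set X} {M Λ : ℝ} (hM : 1 ≤ M) (hΛ : 0 ≤ Λ) :
    Monotone fun j : ℕ => {y | y ∉ E ∧ h y ≤ ENNReal.ofReal (Λ * M ^ j)} :=
  fun _ _ hij _ hy => ⟨hy.1, hy.2.trans (ENNReal.ofReal_le_ofReal (by gcongr))⟩

/-- With `t = p / s` this gives `C * ρ ≤ 1` for `ρ = M ^ (-t)`, as chaining requires. -/
theorem exists_ratio {C t : ℝ} (hC : 1 ≤ C) (ht : 0 < t) :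
    ∃ M : ℝ, 1 < M ∧ C * M ^ (-t) ≤ 1 := by
  refine ⟨max 2 (C ^ (1 / t)), lt_max_of_lt_left one_lt_two, ?_⟩
  have hM : 0 < max 2 (C ^ (1 / t)) := lt_max_of_lt_left two_pos
  rw [Real.rpow_neg hM.le, ← div_eq_mul_inv, div_le_one (by positivity)]
  calc C = (C ^ (1 / t)) ^ t := by
        rw [← Real.rpow_mul (by linarith), one_div, inv_mul_cancel₀ ht.ne', Real.rpow_one]
    _ ≤ _ := Real.rpow_le_rpow (by positivity) (le_max_right _ _) ht.le

/-- The sign of `1 - α * p / s` decides whether the increments along a chain grow or decay, which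
separates the two cases of the theorem. -/
theorem mul_rpow_ratio {M α p s : ℝ} (hM : 0 < M) :
    M * (M ^ (-(p / s))) ^ α = M ^ (1 - α * p / s) := by
  rw [← Real.rpow_mul hM.le, sub_eq_add_neg, Real.rpow_add hM, Real.rpow_one]
  congr 2; ring

theorem exists_level {M Λ : ℝ} (hM : 1 < M) (hΛ : 0 < Λ) {a : ℝ≥0∞} (ha : a < ∞) :
    ∃ k : ℕ, a ≤ ENNReal.ofReal (Λ * M ^ k) := by
  obtain ⟨k, hk⟩ := pow_unbounded_of_one_lt (a.toReal / Λ) hM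
  refine ⟨k, ?_⟩
  rw [← ENNReal.ofReal_toReal ha.ne]
  refine ENNReal.ofReal_le_ofReal ?_
  rw [div_lt_iff₀ hΛ] at hk
  linarith

section

variable [MeasurableSpace X] {d : X → X → ℝ} {μ : Measure X} {C s b α p : ℝ}

theorem ae_lt_top_of_lintegral_rpow {h : X → ℝ≥0∞} (hp : 0 < p) (hh : Measurable h) {A : ℝ}
    (hint : ∫⁻ x, h x ^ p ∂μ ≤ ENNReal.ofReal A) : ∀ᵐ x ∂μ, h x < ∞ := by
  filter_upwards [ae_lt_top (hh.pow_const p) (hint.trans_lt ENNReal.ofReal_lt_top).ne] with x hx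
  by_contra! hcon
  rw [top_le_iff] at hcon
  rw [hcon, ENNReal.top_rpow_of_pos hp] at hx
  exact lt_irrefl _ hx

/-- Fixes the choice `Λ = 2 * (4 / b) ^ (1 / p) * T`, which turns the moment bound of
`exists_admissible` into the one `exists_mem_level` expects. -/
theorem rescale_moment (hp : 0 < p) (hb : 0 < b) {T : ℝ} (hT : 0 < T) :
    2 * (2 * T) ^ p = (2 * (4 / b) ^ (1 / p) * T) ^ p * (b / 2) := by
  rw [show 2 * (4 / b) ^ (1 / p) * T = (4 / b) ^ (1 / p) * (2 * T) by ring,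
    Real.mul_rpow (x := _ ^ _) (by positivity) (by positivity), ← Real.rpow_mul (by positivity),
    one_div, inv_mul_cancel₀ hp.ne', Real.rpow_one]
  field_simp
  norm_num

/-- The Sobolev inequality in terms of admissible functions. -/
theorem exists_eLpNorm_le_of_admissible (hd : IsQuasiMetricWith d C) (hμ : μ Set.univ < ∞)
    (hs : 0 < s) (hα : 0 < α) (hp : 0 < p) (hb : 0 < b)
    (hball : ∀ (x : X) (r : ℝ), 0 < r → r ≤ 1 → ENNReal.ofReal (b * r ^ s) ≤ μ (qball d x r))
    (hsub : α * p < s) :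
    ∃ K : ℝ≥0, ∀ (u : X → ℝ) (h : X → ℝ≥0∞) (E : Set X) (Λ : ℝ), 0 < Λ →
      Admissible d μ α u h E → ∫⁻ x, h x ^ p ∂μ ≤ ENNReal.ofReal (Λ ^ p * (b / 2)) →
      eLpNorm u (ENNReal.ofReal (s * p / (s - α * p))) μ ≤ K * ENNReal.ofReal Λ := by
  obtain ⟨M, hM, hCM⟩ := exists_ratio hd.one_le (div_pos hp hs)
  have hM0 : 0 < M := by linarith
  have hsα : 0 < s - α * p := by linarith
  set P := s * p / (s - α * p) with hP
  have hP0 : 0 < P := by positivity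
  have hθ : 1 < M * (M ^ (-(p / s))) ^ α := by
    rw [mul_rpow_ratio hM0]
    exact Real.one_lt_rpow hM (by rw [sub_pos, div_lt_one hs]; exact hsub)
  have hθP : (M * (M ^ (-(p / s))) ^ α) ^ P = M ^ p := by
    rw [mul_rpow_ratio hM0, ← Real.rpow_mul hM0.le]
    congr 1; rw [hP]; field_simp
  set K₁ := 1 + 2 * M / (M * (M ^ (-(p / s))) ^ α - 1) with hK₁
  have hK₁0 : 0 < K₁ := by
    have : 0 < M * (M ^ (-(p / s))) ^ α - 1 := by linarith
    positivity
  set Q : ℝ≥0∞ := μ Set.univ + ENNReal.ofReal (M ^ p * (b / 2)) with hQ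
  have hQtop : Q ≠ ∞ := ENNReal.add_ne_top.2 ⟨hμ.ne, ENNReal.ofReal_ne_top⟩
  have hQ' : Q ^ (1 / P) ≠ ∞ := ENNReal.rpow_ne_top_of_nonneg (by positivity) hQtop
  refine ⟨(ENNReal.ofReal K₁ * Q ^ (1 / P)).toNNReal, fun u h E Λ hΛ H hint => ?_⟩
  rw [ENNReal.coe_toNNReal (ENNReal.mul_ne_top ENNReal.ofReal_ne_top hQ')]
  refine eLpNorm_le_of_lintegral_rpow hP0 ?_
  have hpt : ∀ᵐ x ∂μ, ‖u x‖ₑ ^ P ≤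
      ENNReal.ofReal (K₁ * Λ) ^ P * (1 + ENNReal.ofReal (M / Λ) ^ p * h x ^ p) := by
    filter_upwards [measure_eq_zero_iff_ae_notMem.1 H.measure_zero,
      ae_lt_top_of_lintegral_rpow hp H.measurable hint] with x hxE hxh
    classical
    -- The least level containing the point is used: minimality bounds `M ^ k` by a multiple of `h
    -- x`, except at `k = 0`, where the summand `1` below takes over.
    have hex := exists_level hM hΛ hxh
    have hk := Nat.find_spec hex
    have hmin := fun m => Nat.find_min hex (m := m)
    generalize Nat.find hex = k at hk hmin
    have hu : |u x| ≤ K₁ * Λ * (M * (M ^ (-(p / s))) ^ α) ^ k :=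
      hd.abs_le_of_one_lt (u := u) (S := fun j => {y | y ∉ E ∧ h y ≤ ENNReal.ofReal (Λ * M ^ j)})
        (by positivity) hCM hα hM.le hΛ.le (monotone_level hM.le hΛ.le)
        (exists_mem_level hb hs hp hM.le hΛ hball H.measurable H.measure_zero hint)
        (fun j x hx y hy => by
          have := H.abs_sub_le hd.nonneg (by positivity) hx hy
          rwa [← mul_assoc] at this)
        (fun x hx => H.abs_le_real hΛ.le (by simpa using hx.2)) hθ ⟨hxE, hk⟩
    have hMk : ENNReal.ofReal (M ^ k) ^ p ≤ 1 + ENNReal.ofReal (M / Λ) ^ p * h x ^ p := by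
      cases k with
      | zero => simp
      | succ k =>
        have hlt := not_le.1 (hmin k (Nat.lt_succ_self k))
        refine le_trans ?_ le_add_self
        rw [← ENNReal.mul_rpow_of_nonneg _ _ hp.le]
        refine ENNReal.rpow_le_rpow ?_ hp.le
        calc ENNReal.ofReal (M ^ (k + 1)) = ENNReal.ofReal (M / Λ) * ENNReal.ofReal (Λ * M ^ k) := by
              rw [← ENNReal.ofReal_mul (by positivity)]
              congr 1; field_simp; ring
          _ ≤ _ := by gcongr
    calc ‖u x‖ₑ ^ P ≤ ENNReal.ofReal (K₁ * Λ * (M * (M ^ (-(p / s))) ^ α) ^ k) ^ P := by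
          rw [Real.enorm_eq_ofReal_abs]
          exact ENNReal.rpow_le_rpow (ENNReal.ofReal_le_ofReal hu) hP0.le
      _ = ENNReal.ofReal (K₁ * Λ) ^ P * ENNReal.ofReal (M ^ k) ^ p := by
          rw [ENNReal.ofReal_mul (by positivity), ENNReal.mul_rpow_of_nonneg _ _ hP0.le,
            ENNReal.ofReal_rpow_of_pos (x := _ ^ k) (by positivity),
            ENNReal.ofReal_rpow_of_pos (x := M ^ k) (by positivity)]
          congr 2
          rw [← Real.rpow_natCast, ← Real.rpow_mul (by positivity), mul_comm (k : ℝ),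
            Real.rpow_mul (by positivity), hθP, ← Real.rpow_natCast M, ← Real.rpow_mul hM0.le,
            ← Real.rpow_mul hM0.le, mul_comm p]
      _ ≤ _ := by gcongr
  calc ∫⁻ x, ‖u x‖ₑ ^ P ∂μ
      ≤ ∫⁻ x, ENNReal.ofReal (K₁ * Λ) ^ P * (1 + ENNReal.ofReal (M / Λ) ^ p * h x ^ p) ∂μ :=
        lintegral_mono_ae hpt
    _ = ENNReal.ofReal (K₁ * Λ) ^ P *
          (μ Set.univ + ENNReal.ofReal (M / Λ) ^ p * ∫⁻ x, h x ^ p ∂μ) := by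
        rw [lintegral_const_mul _ (by have := H.measurable; fun_prop),
          lintegral_add_left measurable_const,
          lintegral_const_mul _ (H.measurable.pow_const p)]
        simp
    _ ≤ ENNReal.ofReal (K₁ * Λ) ^ P *
          (μ Set.univ + ENNReal.ofReal (M / Λ) ^ p * ENNReal.ofReal (Λ ^ p * (b / 2))) := by
        gcongr
    _ = ENNReal.ofReal (K₁ * Λ) ^ P * Q := by
        rw [hQ, ENNReal.ofReal_rpow_of_pos (x := M / Λ) (by positivity), ← ENNReal.ofReal_mul (by positivity),
          Real.div_rpow hM0.le hΛ.le]
        have : 0 < Λ ^ p := by positivity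
        congr 3
        field_simp
    _ = (ENNReal.ofReal K₁ * Q ^ (1 / P) * ENNReal.ofReal Λ) ^ P := by
        rw [ENNReal.ofReal_mul hK₁0.le, mul_right_comm, ENNReal.mul_rpow_of_nonneg _ (Q ^ _) hP0.le,
          ← ENNReal.rpow_mul, one_div, inv_mul_cancel₀ hP0.ne', ENNReal.rpow_one]

/-- The Sobolev embedding in the subcritical range, with arbitrary upper bounds of the norm. -/
theorem exists_eLpNorm_le (hd : IsQuasiMetricWith d C) (hμ : μ Set.univ < ∞)
    (hs : 0 < s) (hreg : IsLocallyLowerAhlforsRegular d μ s) (hα : 0 < α) (hp : 0 < p)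
    (hsub : α * p < s) :
    ∃ K : ℝ≥0, ∀ u ∈ (hajlaszSobolev d μ α (ENNReal.ofReal p)).carrier, ∀ T : ℝ, 0 < T →
      (hajlaszSobolev d μ α (ENNReal.ofReal p)).norm u ≤ ENNReal.ofReal T →
      eLpNorm u (ENNReal.ofReal (s * p / (s - α * p))) μ ≤ K * ENNReal.ofReal T := by
  obtain ⟨b, hb, hball⟩ := hreg
  obtain ⟨K, hK⟩ := exists_eLpNorm_le_of_admissible hd hμ hs hα hp hb hball hsub
  refine ⟨K * (2 * (4 / b) ^ (1 / p)).toNNReal, fun u hu T hT hnorm => ?_⟩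
  obtain ⟨h, E, H, hint⟩ := exists_admissible hp hu hT hnorm
  rw [rescale_moment hp hb hT] at hint
  refine (hK u h E _ (by positivity) H hint).trans_eq ?_
  rw [ENNReal.ofReal_mul (by positivity), ENNReal.coe_mul, mul_assoc]
  rfl

theorem sobolev_embedsContinuously (hd : IsQuasiMetricWith d C) (hμ : μ Set.univ < ∞)
    (hs : 0 < s) (hreg : IsLocallyLowerAhlforsRegular d μ s) (hα : 0 < α) (hp : 0 < p)
    (hsub : α * p < s) :
    EmbedsContinuously μ (hajlaszSobolev d μ α (ENNReal.ofReal p))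
      (lebesgueSpace μ (ENNReal.ofReal (s * p / (s - α * p)))) := by
  obtain ⟨K, hK⟩ := exists_eLpNorm_le hd hμ hs hreg hα hp hsub
  refine embedsContinuously_of_forall hp (MemLp.zero' (ε := ℝ)) (by simp [lebesgueSpace]) K
    fun u hu T hT hnorm => ⟨u, ⟨hu.1.aestronglyMeasurable, ?_⟩, EventuallyEq.rfl,
      hK u hu T hT hnorm⟩
  exact (hK u hu T hT hnorm).trans_lt (by finiteness)

/-- The Hölder embedding in the supercritical range, with arbitrary upper bounds of the norm. -/
theorem exists_holder_le (hd : IsQuasiMetricWith d C)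
    (hs : 0 < s) (hreg : IsLocallyLowerAhlforsRegular d μ s) (hα : 0 < α) (hp : 0 < p)
    (hsup : s < α * p) :
    ∃ K : ℝ, 0 < K ∧ ∀ u ∈ (hajlaszSobolev d μ α (ENNReal.ofReal p)).carrier, ∀ T : ℝ, 0 < T →
      (hajlaszSobolev d μ α (ENNReal.ofReal p)).norm u ≤ ENNReal.ofReal T →
      ∃ v : X → ℝ, v =ᵐ[μ] u ∧ (∀ x, |v x| ≤ K * T) ∧
        ∀ x y, |v x - v y| ≤ K * T * d x y ^ (α - s / p) := by
  obtain ⟨b, hb, hball⟩ := hreg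
  obtain ⟨M, hM, hCM⟩ := exists_ratio hd.one_le (div_pos hp hs)
  have hM0 : 0 < M := by linarith
  have hβ : 0 < α - s / p := by rw [sub_pos, div_lt_iff₀ hp]; exact hsup
  set β := α - s / p with hβdef
  have hρ1 : M ^ (-(p / s)) < 1 :=
    Real.rpow_lt_one_of_one_lt_of_neg hM (by rw [neg_lt_zero]; positivity)
  have hθ : M * (M ^ (-(p / s))) ^ α < 1 := by
    rw [mul_rpow_ratio hM0]
    exact Real.rpow_lt_one_of_one_lt_of_neg hM (by rw [sub_neg, one_lt_div hs]; exact hsup)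
  have hρβ : (M ^ (-(p / s))) ^ β = M * (M ^ (-(p / s))) ^ α := by
    rw [mul_rpow_ratio hM0, ← Real.rpow_mul hM0.le, hβdef]
    congr 1; field_simp; ring
  have hC := hd.const_pos
  set K₁ := 1 + 2 * M / (1 - M * (M ^ (-(p / s))) ^ α) with hK₁
  set K₂ := (4 * M / (1 - M * (M ^ (-(p / s))) ^ α) + 2 * (C ^ 3) ^ α) /
    (M * (M ^ (-(p / s))) ^ α) with hK₂
  have h1θ : 0 < 1 - M * (M ^ (-(p / s))) ^ α := by linarith
  have hK₁0 : 0 < K₁ := by positivity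
  have hK₂0 : 0 < K₂ := by positivity
  set c := 2 * (4 / b) ^ (1 / p) with hc
  have hc0 : 0 < c := by positivity
  refine ⟨(2 * K₁ + (2 * K₁ + K₂) * (C ^ 2) ^ β) * c, by positivity, fun u hu T hT hnorm => ?_⟩
  obtain ⟨h, E, H, hint⟩ := exists_admissible hp hu hT hnorm
  rw [rescale_moment hp hb hT, ← hc] at hint
  set Λ := c * T with hΛdef
  have hΛ : 0 < Λ := by positivity
  let S : ℕ → Set X := fun j => {y | y ∉ E ∧ h y ≤ ENNReal.ofReal (Λ * M ^ j)}
  have hmono : Monotone S := monotone_level hM.le hΛ.le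
  have hstep : ∀ x j, ∃ y ∈ S j, d x y < (M ^ (-(p / s))) ^ j :=
    exists_mem_level hb hs hp hM.le hΛ hball H.measurable H.measure_zero hint
  have hosc : ∀ j, ∀ x ∈ S j, ∀ y ∈ S j, |u x - u y| ≤ 2 * Λ * M ^ j * d x y ^ α :=
    fun j x hx y hy => by
      have := H.abs_sub_le hd.nonneg (by positivity) hx hy
      rwa [← mul_assoc] at this
  have hzero : ∀ x ∈ S 0, |u x| ≤ Λ := fun x hx => H.abs_le_real hΛ.le (by simpa using hx.2)
  have hbd : ∀ x ∈ ⋃ j, S j, |u x| ≤ K₁ * Λ := fun x hx => by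
    obtain ⟨k, hk⟩ := Set.mem_iUnion.1 hx
    exact hd.abs_le_of_lt_one (by positivity) hCM hα hM.le hΛ.le hmono hstep hosc hzero hθ hk
  have hhol : ∀ x ∈ ⋃ j, S j, ∀ y ∈ ⋃ j, S j,
      |u x - u y| ≤ (2 * K₁ + K₂) * Λ * d x y ^ β := fun x hx y hy => by
    rcases eq_or_ne x y with rfl | hxy
    · rw [sub_self, abs_zero]
      have := Real.rpow_nonneg (hd.nonneg x x) β
      positivity
    have hdpos := hd.pos hxy
    have hdβ : 0 < d x y ^ β := Real.rpow_pos_of_pos hdpos β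
    -- Chaining handles distances up to `1`; beyond that the bound on `|u|` suffices.
    rcases le_total (d x y) 1 with h1 | h1
    · obtain ⟨i, hi⟩ := Set.mem_iUnion.1 hx
      obtain ⟨j, hj⟩ := Set.mem_iUnion.1 hy
      refine (hd.abs_sub_le_of_lt_one (by positivity) hρ1 hCM hα hM.le hΛ.le hmono hstep hosc hβ hθ
        hρβ (hmono (le_max_left i j) hi) (hmono (le_max_right i j) hj) hdpos h1).trans ?_
      rw [← hK₂]
      gcongr
      linarith
    · have h2 : 1 ≤ d x y ^ β := Real.one_le_rpow h1 hβ.le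
      calc |u x - u y| ≤ |u x| + |u y| := abs_sub _ _
        _ ≤ K₁ * Λ + K₁ * Λ := add_le_add (hbd x hx) (hbd y hy)
        _ = 2 * K₁ * Λ * 1 := by ring
        _ ≤ (2 * K₁ + K₂) * Λ * d x y ^ β := by gcongr; linarith
  have hdense : ∀ x, ∀ ε : ℝ, 0 < ε → ∃ y ∈ ⋃ j, S j, d x y < ε := fun x ε hε => by
    obtain ⟨j, hj⟩ := exists_pow_lt_of_lt_one hε hρ1
    obtain ⟨y, hy, hxy⟩ := hstep x j
    exact ⟨y, Set.mem_iUnion.2 ⟨j, hy⟩, hxy.trans hj⟩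
  obtain ⟨v, hvu, hvB, hvH⟩ := hd.exists_holder_extension hβ (by positivity) hdense hhol hbd
  refine ⟨v, ?_, fun x => (hvB x).trans ?_, fun x y => (hvH x y).trans ?_⟩
  · filter_upwards [measure_eq_zero_iff_ae_notMem.1 H.measure_zero,
      ae_lt_top_of_lintegral_rpow hp H.measurable hint] with x hxE hxh
    obtain ⟨k, hk⟩ := exists_level hM hΛ hxh
    exact hvu x (Set.mem_iUnion.2 ⟨k, hxE, hk⟩)
  · rw [hΛdef, ← mul_assoc]
    have : 0 < (2 * K₁ + K₂) * (C ^ 2) ^ β := by positivity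
    gcongr
    linarith
  · have e : (2 * K₁ + K₂) * Λ * (C ^ 2) ^ β * d x y ^ β
        = (2 * K₁ + K₂) * (C ^ 2) ^ β * c * T * d x y ^ β := by rw [hΛdef]; ring
    rw [e]
    have := Real.rpow_nonneg (hd.nonneg x y) β
    gcongr
    linarith

theorem holder_embedsContinuously (hd : IsQuasiMetricWith d C)
    (hs : 0 < s) (hreg : IsLocallyLowerAhlforsRegular d μ s) (hα : 0 < α) (hp : 0 < p)
    (hsup : s < α * p) :
    EmbedsContinuously μ (hajlaszSobolev d μ α (ENNReal.ofReal p)) (holderSpace d (α - s / p)) := by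
  obtain ⟨K, hK, hKu⟩ := exists_holder_le hd hs hreg hα hp hsup
  have h0 : holderNorm d (α - s / p) (0 : X → ℝ) = 0 := by simp [holderNorm, holderSeminorm]
  refine embedsContinuously_of_forall hp (by simp [holderSpace, h0]) h0 (2 * K).toNNReal
    fun u hu T hT hnorm => ?_
  obtain ⟨v, hvu, hvA, hvB⟩ := hKu u hu T hT hnorm
  have hv := holderNorm_le hd (by positivity) (by positivity) hvA hvB
  refine ⟨v, hv.trans_lt ENNReal.ofReal_lt_top, hvu, hv.trans_eq ?_⟩
  rw [← two_mul, ← mul_assoc, ENNReal.ofReal_mul (by positivity)]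
  rfl

end

/-! ### Interpolation and reduction of the other scales to Hajłasz–Sobolev spaces -/

/-- Interpolation between boundedness and Hölder continuity. -/
theorem abs_sub_le_interpolate {d : X → X → ℝ} {C : ℝ} (hd : IsQuasiMetricWith d C) {β γ η H : ℝ}
    (hγ : 0 < γ) (hγβ : γ < β) (hη : 0 ≤ η) (hH : 0 ≤ H) {f : X → ℝ} (hfη : ∀ x, |f x| ≤ η)
    (hfH : ∀ x y, |f x - f y| ≤ H * d x y ^ β) (x y : X) :
    |f x - f y| ≤ (2 * η) ^ (1 - γ / β) * H ^ (γ / β) * d x y ^ γ := by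
  have hβ : 0 < β := hγ.trans hγβ
  have ht : γ / β < 1 := (div_lt_one hβ).2 hγβ
  have h1 : |f x - f y| ≤ 2 * η := by
    calc _ ≤ |f x| + |f y| := abs_sub _ _
      _ ≤ _ := by linarith [hfη x, hfη y]
  calc |f x - f y| = |f x - f y| ^ (1 - γ / β) * |f x - f y| ^ (γ / β) := by
        rw [← Real.rpow_add_of_nonneg (abs_nonneg _) (by linarith) (by positivity)]
        simp
    _ ≤ (2 * η) ^ (1 - γ / β) * (H * d x y ^ β) ^ (γ / β) := by
        gcongr
        exact hfH x y
    _ = _ := by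
        have := hd.nonneg x y
        rw [Real.mul_rpow hH (by positivity), ← Real.rpow_mul this, mul_div_cancel₀ _ hβ.ne',
          mul_assoc]

theorem lqNorm_ge {q : ℝ≥0∞} (hq : 0 < q) (a : ℤ → ℝ≥0∞) (k : ℤ) : a k ≤ lqNorm q a := by
  unfold lqNorm
  split_ifs with h
  · exact le_iSup a k
  · have hq' : 0 < q.toReal := ENNReal.toReal_pos hq.ne' h
    calc a k = (a k ^ q.toReal) ^ (1 / q.toReal) := by
          rw [← ENNReal.rpow_mul, mul_one_div_cancel hq'.ne', ENNReal.rpow_one]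
      _ ≤ _ := ENNReal.rpow_le_rpow (ENNReal.le_tsum k) (by positivity)

theorem exists_dyadic {t : ℝ} (ht : 0 < t) : ∃ k : ℤ, (2 : ℝ) ^ (-k - 1) ≤ t ∧ t < (2 : ℝ) ^ (-k) := by
  obtain ⟨n, hn⟩ := exists_mem_Ico_zpow ht one_lt_two
  exact ⟨-n - 1, by simpa using hn.1, by simpa [add_comm] using hn.2⟩

section

variable [MeasurableSpace X] {d : X → X → ℝ} {μ : Measure X} {C s α p : ℝ}

theorem EmbedsCompactly.of_norm_le {A A' B : FunctionSpace X} (h : EmbedsCompactly μ A' B) (K : ℝ≥0)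
    (hsub : A.carrier ⊆ A'.carrier) (hnorm : ∀ u ∈ A.carrier, A'.norm u ≤ K * A.norm u) :
    EmbedsCompactly μ A B := by
  obtain ⟨⟨K', hK'⟩, hc⟩ := h
  refine ⟨⟨K' * K, fun u hu => ?_⟩, fun u hu ⟨R, hR⟩ => ?_⟩
  · obtain ⟨v, hv, hvu, hvn⟩ := hK' u (hsub hu)
    refine ⟨v, hv, hvu, hvn.trans ?_⟩
    rw [ENNReal.coe_mul, mul_assoc]
    gcongr
    exact hnorm u hu
  · refine hc u (fun n => hsub (hu n)) ⟨K * R, fun n => (hnorm _ (hu n)).trans ?_⟩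
    rw [ENNReal.coe_mul]
    gcongr
    exact hR n

theorem measurable_lqNorm {q : ℝ≥0∞} {g : ℤ → X → ℝ≥0∞} (hg : ∀ k, Measurable (g k)) :
    Measurable fun x => lqNorm q fun k => g k x := by
  unfold lqNorm
  split_ifs with h
  · exact Measurable.iSup hg
  · exact (Measurable.tsum fun k => (hg k).pow_const _).pow_const _

/-- A function dominating the rescaled components of a fractional gradient is a gradient. -/
theorem IsFractionalGradient.isHajlaszGradient {C : ℝ} (hd : IsQuasiMetricWith d C) {α' : ℝ}
    {u : X → ℝ} {g : ℤ → X → ℝ≥0∞} (hg : IsFractionalGradient d μ α u g) {G : X → ℝ≥0∞}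
    (hG : Measurable G)
    (hgG : ∀ (k : ℤ) (x y z : X), (2 : ℝ) ^ (-k - 1) ≤ d x y → d x y < (2 : ℝ) ^ (-k) →
      ENNReal.ofReal (d x y ^ (α - α')) * g k z ≤ G z) :
    IsHajlaszGradient d μ α' u G := by
  obtain ⟨-, E, hEm, hE0, hE⟩ := hg
  refine ⟨hG, E, hEm, hE0, fun x y hx hy => ?_⟩
  rcases eq_or_ne x y with rfl | hxy
  · simp
  have hpos := hd.pos hxy
  obtain ⟨k, hk1, hk2⟩ := exists_dyadic hpos
  refine (hE k x y hx hy hk1 hk2).trans ?_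
  have e : ENNReal.ofReal (d x y ^ α)
      = ENNReal.ofReal (d x y ^ α') * ENNReal.ofReal (d x y ^ (α - α')) := by
    rw [← ENNReal.ofReal_mul (by positivity), ← Real.rpow_add hpos]
    congr 2; ring
  rw [e, mul_assoc, mul_add]
  gcongr
  · exact hgG k x y x hk1 hk2
  · exact hgG k x y y hk1 hk2

/-- The pointwise `ℓ^q` norm dominates every component, hence is itself a gradient with no loss in
`α`. -/
theorem hajlaszSobolevSeminorm_le_triebelLizorkin (hd : IsQuasiMetricWith d C) {P q : ℝ≥0∞}
    (hq : 0 < q) (u : X → ℝ) :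
    hajlaszSobolevSeminorm d μ α P u ≤ triebelLizorkinSeminorm d μ α P q u :=
  le_iInf₂ fun g hg => iInf₂_le_of_le (fun x => lqNorm q fun k => g k x)
    (hg.isHajlaszGradient hd (measurable_lqNorm hg.1) fun k x y z _ _ => by
      simpa using lqNorm_ge hq (fun k => g k z) k) le_rfl

theorem EmbedsCompactly.triebelLizorkin (hd : IsQuasiMetricWith d C) {P q : ℝ≥0∞} (hq : 0 < q)
    {B : FunctionSpace X} (h : EmbedsCompactly μ (hajlaszSobolev d μ α P) B) :
    EmbedsCompactly μ (hajlaszTriebelLizorkin d μ α P q) B := by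
  have hle := hajlaszSobolevSeminorm_le_triebelLizorkin (μ := μ) (α := α) (P := P) hd hq
  refine h.of_norm_le 1 (fun u hu => ⟨hu.1, hu.2.1, (hle u).trans_lt hu.2.2⟩) fun u _ => ?_
  rw [ENNReal.coe_one, one_mul]
  exact add_le_add le_rfl (hle u)

/-- On a bounded space the Hajłasz-Besov spaces embed into Hajłasz-Sobolev spaces of lower order. -/
theorem exists_hajlaszSobolevSeminorm_le_besov (hd : IsQuasiMetricWith d C) {D : ℝ}
    (hD : ∀ x y, d x y < D) (hp : 0 < p) {q : ℝ≥0∞} (hq : 0 < q) {α' : ℝ} (hα' : α' < α) :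
    ∃ K : ℝ≥0, ∀ u : X → ℝ, hajlaszSobolevSeminorm d μ α' (ENNReal.ofReal p) u ≤
      K * besovSeminorm d μ α (ENNReal.ofReal p) q u := by
  -- As all distances are below `2 ^ N`, only the indices `k = n - N` with `n ≥ 0` matter. On scale
  -- `k`, `d ^ (α - α')` is at most `W * r ^ n`, which decays geometrically.
  obtain ⟨N, hN⟩ := pow_unbounded_of_one_lt D one_lt_two
  have hδ : 0 < α - α' := by linarith
  set W : ℝ≥0∞ := ENNReal.ofReal (((2 : ℝ) ^ N) ^ (α - α')) with hW
  set r : ℝ≥0∞ := ENNReal.ofReal ((1 / 2 : ℝ) ^ (α - α')) with hr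
  have hr1 : r ^ p < 1 := by
    refine ENNReal.rpow_lt_one ?_ hp
    rw [hr, ENNReal.ofReal_lt_one]
    exact Real.rpow_lt_one (by norm_num) (by norm_num) hδ
  set Z : ℝ≥0∞ := (1 - r ^ p)⁻¹ with hZ
  have hZtop : Z ≠ ∞ := ENNReal.inv_ne_top.2 (tsub_pos_iff_lt.2 hr1).ne'
  have hKtop : W * Z ^ (1 / p) ≠ ∞ :=
    ENNReal.mul_ne_top ENNReal.ofReal_ne_top (ENNReal.rpow_ne_top_of_nonneg (by positivity) hZtop)
  refine ⟨(W * Z ^ (1 / p)).toNNReal, fun u => ?_⟩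
  rw [ENNReal.coe_toNNReal hKtop, besovSeminorm]
  by_cases h0 : W * Z ^ (1 / p) = 0
  · exfalso
    have hZ0 : Z ≠ 0 := ENNReal.inv_ne_zero.2 (by finiteness)
    rcases mul_eq_zero.1 h0 with h | h
    · rw [hW, ENNReal.ofReal_eq_zero] at h
      have : (0 : ℝ) < ((2 : ℝ) ^ N) ^ (α - α') := by positivity
      linarith
    · exact (ENNReal.rpow_pos (pos_iff_ne_zero.2 hZ0) hZtop).ne' h
  rw [ENNReal.mul_iInf_of_ne h0 hKtop]
  refine le_iInf fun g => ?_
  rw [ENNReal.mul_iInf_of_ne h0 hKtop]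
  refine le_iInf fun hg => ?_
  set b := lqNorm q fun k => eLpNorm (g k) (ENNReal.ofReal p) μ with hb
  -- An `ℓ^p` sum dominates each term and commutes with the integral of `p`-th powers, so no
  -- triangle inequality is needed and `p < 1` is allowed. The integral needs only the supremum of
  -- the component norms, whence any `q`.
  let G : X → ℝ≥0∞ := fun x => (∑' n : ℕ, (W * r ^ n * g (n - N) x) ^ p) ^ (1 / p)
  have hterm : ∀ n : ℕ, Measurable fun x => (W * r ^ n * g (n - N) x) ^ p := fun n =>
    ((hg.1 _).const_mul _).pow_const _
  have hGm : Measurable G := (Measurable.tsum hterm).pow_const _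
  refine iInf₂_le_of_le G (hg.isHajlaszGradient hd hGm fun k x y z hk1 hk2 => ?_) ?_
  · have hkN : -(N : ℤ) ≤ k := by
      have h1 : (2 : ℝ) ^ (-k - 1) < (2 : ℝ) ^ (N : ℤ) := by
        rw [zpow_natCast]; exact hk1.trans_lt ((hD x y).trans hN)
      have := (zpow_lt_zpow_iff_right₀ one_lt_two).1 h1
      omega
    obtain ⟨n, hn⟩ := Int.eq_ofNat_of_zero_le (show 0 ≤ k + N by omega)
    obtain rfl : k = (n : ℤ) - N := by omega
    have hwt : ENNReal.ofReal (d x y ^ (α - α')) ≤ W * r ^ n := by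
      rw [hW, hr, ← ENNReal.ofReal_pow (by positivity), ← ENNReal.ofReal_mul (by positivity)]
      refine ENNReal.ofReal_le_ofReal ?_
      rw [← Real.rpow_natCast (_ ^ (α - α')), ← Real.rpow_mul (by norm_num), mul_comm (α - α'),
        Real.rpow_mul (by norm_num), Real.rpow_natCast,
        ← Real.mul_rpow (by positivity) (by positivity)]
      refine Real.rpow_le_rpow (hd.nonneg _ _) (hk2.le.trans_eq ?_) hδ.le
      rw [neg_sub, zpow_sub₀ two_ne_zero, zpow_natCast, zpow_natCast, one_div, inv_pow,
        div_eq_mul_inv]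
    calc ENNReal.ofReal (d x y ^ (α - α')) * g (n - N) z
        ≤ W * r ^ n * g (n - N) z := by gcongr
      _ = ((W * r ^ n * g (n - N) z) ^ p) ^ (1 / p) := by
          rw [← ENNReal.rpow_mul, mul_one_div_cancel hp.ne', ENNReal.rpow_one]
      _ ≤ G z := ENNReal.rpow_le_rpow
          (ENNReal.le_tsum (f := fun n : ℕ => (W * r ^ n * g (n - N) z) ^ p) n) (by positivity)
  · refine eLpNorm_le_of_lintegral_rpow hp ?_
    have hgb : ∀ k, ∫⁻ x, g k x ^ p ∂μ ≤ b ^ p := fun k => by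
      simpa using lintegral_rpow_of_eLpNorm_le hp
        (lqNorm_ge hq (fun k => eLpNorm (g k) (ENNReal.ofReal p) μ) k)
    calc ∫⁻ x, ‖G x‖ₑ ^ p ∂μ = ∫⁻ x, ∑' n : ℕ, (W * r ^ n * g (n - N) x) ^ p ∂μ := by
          refine lintegral_congr fun x => ?_
          rw [enorm_eq_self, ← ENNReal.rpow_mul, one_div, inv_mul_cancel₀ hp.ne', ENNReal.rpow_one]
      _ = ∑' n : ℕ, W ^ p * (r ^ p) ^ n * ∫⁻ x, g (n - N) x ^ p ∂μ := by
          rw [lintegral_tsum fun n => (hterm n).aemeasurable]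
          refine tsum_congr fun n => ?_
          rw [← lintegral_const_mul _ ((hg.1 _).pow_const p)]
          refine lintegral_congr fun x => ?_
          rw [ENNReal.mul_rpow_of_nonneg _ _ hp.le, ENNReal.mul_rpow_of_nonneg _ _ hp.le,
            ← ENNReal.rpow_natCast, ← ENNReal.rpow_natCast, ← ENNReal.rpow_mul, ← ENNReal.rpow_mul,
            mul_comm p]
      _ ≤ ∑' n : ℕ, W ^ p * (r ^ p) ^ n * b ^ p := by
          gcongr
          exact hgb _
      _ = (W * Z ^ (1 / p) * b) ^ p := by
          rw [ENNReal.tsum_mul_right, ENNReal.tsum_mul_left, ENNReal.tsum_geometric,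
            ENNReal.mul_rpow_of_nonneg _ _ hp.le, ENNReal.mul_rpow_of_nonneg _ _ hp.le,
            ← ENNReal.rpow_mul, one_div, inv_mul_cancel₀ hp.ne', ENNReal.rpow_one]

theorem EmbedsCompactly.besov (hd : IsQuasiMetricWith d C) {D : ℝ} (hD : ∀ x y, d x y < D)
    (hp : 0 < p) {q : ℝ≥0∞} (hq : 0 < q) {α' : ℝ} (hα' : α' < α) {B : FunctionSpace X}
    (h : EmbedsCompactly μ (hajlaszSobolev d μ α' (ENNReal.ofReal p)) B) :
    EmbedsCompactly μ (hajlaszBesov d μ α (ENNReal.ofReal p) q) B := by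
  obtain ⟨K, hK⟩ := exists_hajlaszSobolevSeminorm_le_besov (μ := μ) hd hD hp hq hα'
  refine h.of_norm_le (1 + K) (fun u hu => ⟨hu.1, hu.2.1, (hK u).trans_lt
    (ENNReal.mul_lt_top ENNReal.coe_lt_top hu.2.2)⟩) fun u _ => ?_
  rw [ENNReal.coe_add, ENNReal.coe_one]
  calc eLpNorm u (ENNReal.ofReal p) μ + hajlaszSobolevSeminorm d μ α' (ENNReal.ofReal p) u
      ≤ 1 * eLpNorm u (ENNReal.ofReal p) μ + K * besovSeminorm d μ α (ENNReal.ofReal p) q u := by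
        rw [one_mul]; gcongr; exact hK u
    _ ≤ (1 + K) * eLpNorm u (ENNReal.ofReal p) μ
        + (1 + K) * besovSeminorm d μ α (ENNReal.ofReal p) q u := by
        gcongr
        · exact le_self_add
        · exact le_add_self
    _ = _ := (mul_add _ _ _).symm

/-! ### Compactness in Hölder spaces -/

/-- Compactness of the Hölder embedding. -/
theorem embedsCompactly_holder (hd : IsQuasiMetricWith d C)
    (htb : ∀ ε : ℝ, 0 < ε → ∃ F : Finset X, ∀ x, ∃ z ∈ F, d x z < ε)
    (hs : 0 < s) (hreg : IsLocallyLowerAhlforsRegular d μ s) (hα : 0 < α) (hp : 0 < p)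
    (hsup : s < α * p) {γ : ℝ} (hγ : 0 < γ) (hγβ : γ < α - s / p) :
    EmbedsCompactly μ (hajlaszSobolev d μ α (ENNReal.ofReal p)) (holderSpace d γ) := by
  obtain ⟨K, hK, hKu⟩ := exists_holder_le hd hs hreg hα hp hsup
  set β := α - s / p
  have hβ : 0 < β := hγ.trans hγβ
  have ht : γ / β < 1 := (div_lt_one hβ).2 hγβ
  have hnorm : ∀ {η H : ℝ} {f : X → ℝ}, 0 ≤ η → 0 ≤ H → (∀ x, |f x| ≤ η) →
      (∀ x y, |f x - f y| ≤ H * d x y ^ β) →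
      holderNorm d γ f ≤ ENNReal.ofReal (η + (2 * η) ^ (1 - γ / β) * H ^ (γ / β)) :=
    fun hη hH hfη hfH => holderNorm_le hd hη (by positivity) hfη
      (abs_sub_le_interpolate hd hγ hγβ hη hH hfη hfH)
  refine ⟨?_, fun u hu ⟨R, hR⟩ => ?_⟩
  · have h0 : holderNorm d γ (0 : X → ℝ) = 0 := by simp [holderNorm, holderSeminorm]
    refine embedsContinuously_of_forall hp (by simp [holderSpace, h0]) h0 (3 * K).toNNReal
      fun u hu T hT hn => ?_
    obtain ⟨v, hvu, hvA, hvB⟩ := hKu u hu T hT hn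
    have hKT : 0 < K * T := by positivity
    have hv := hnorm hKT.le hKT.le hvA hvB
    refine ⟨v, hv.trans_lt ENNReal.ofReal_lt_top, hvu, hv.trans ?_⟩
    calc ENNReal.ofReal (K * T + (2 * (K * T)) ^ (1 - γ / β) * (K * T) ^ (γ / β))
        ≤ ENNReal.ofReal (3 * K * T) := by
          refine ENNReal.ofReal_le_ofReal ?_
          have : (2 * (K * T)) ^ (1 - γ / β) * (K * T) ^ (γ / β) ≤ 2 * (K * T) := by
            calc _ ≤ (2 * (K * T)) ^ (1 - γ / β) * (2 * (K * T)) ^ (γ / β) := by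
                  exact mul_le_mul_of_nonneg_left
                    (Real.rpow_le_rpow hKT.le (by linarith) (by positivity)) (by positivity)
              _ = 2 * (K * T) := by rw [← Real.rpow_add (by positivity)]; simp
          linarith
      _ = _ := by rw [ENNReal.ofReal_mul (by positivity)]; rfl
  · have hT : (0 : ℝ) < R + 1 := by positivity
    have hR' : ∀ n, (hajlaszSobolev d μ α (ENNReal.ofReal p)).norm (u n) ≤
        ENNReal.ofReal ((R : ℝ) + 1) := fun n => (hR n).trans (by
      rw [← ENNReal.ofReal_coe_nnreal]; exact ENNReal.ofReal_le_ofReal (by linarith))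
    choose v hvu hvA hvB using fun n => hKu (u n) (hu n) _ hT (hR' n)
    set A : ℝ := K * (R + 1) with hA
    have hA0 : 0 < A := by positivity
    obtain ⟨φ, hφ, hcau⟩ := hd.exists_subseq_cauchy htb hβ v (fun _ _ => Set.univ) (fun _ => A)
      (fun _ n x _ y _ => hvB n x y) (fun _ n x _ => hvA n x)
    have hcs : ∀ x, CauchySeq fun n => v (φ n) x := fun x =>
      cauchySeq_of_le_tendsto_0 _ (fun n m N hn hm => hcau N n m hn hm x (by simp))
        (tendsto_pow_atTop_nhds_zero_of_lt_one (by norm_num) (by norm_num))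
    choose w hw using fun x => cauchySeq_tendsto_of_complete (hcs x)
    have hwA : ∀ x, |w x| ≤ A := fun x =>
      le_of_tendsto (hw x).abs (Eventually.of_forall fun n => hvA _ x)
    have hwB : ∀ x y, |w x - w y| ≤ A * d x y ^ β := fun x y =>
      le_of_tendsto ((hw x).sub (hw y)).abs (Eventually.of_forall fun n => hvB _ x y)
    have hvw : ∀ n x, |(v (φ n) - w) x| ≤ (1 / 2) ^ n := fun n x =>
      le_of_tendsto (tendsto_const_nhds.sub (hw x)).abs ((eventually_ge_atTop n).mono fun m hm =>
        hcau n n m le_rfl hm x (by simp))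
    have hvwB : ∀ n x y, |(v (φ n) - w) x - (v (φ n) - w) y| ≤ 2 * A * d x y ^ β := fun n x y => by
      calc |(v (φ n) - w) x - (v (φ n) - w) y|
          = |(v (φ n) x - v (φ n) y) - (w x - w y)| := by
            congr 1; simp only [Pi.sub_apply]; ring
        _ ≤ |v (φ n) x - v (φ n) y| + |w x - w y| := abs_sub _ _
        _ ≤ A * d x y ^ β + A * d x y ^ β := add_le_add (hvB _ x y) (hwB x y)
        _ = _ := by ring
    refine ⟨φ, hφ, fun n => v (φ n), fun n => ⟨?_, hvu _⟩, w, ?_, ?_⟩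
    · exact (hnorm hA0.le hA0.le (hvA _) (hvB _)).trans_lt ENNReal.ofReal_lt_top
    · exact (hnorm hA0.le hA0.le hwA hwB).trans_lt ENNReal.ofReal_lt_top
    · refine tendsto_of_tendsto_of_tendsto_of_le_of_le tendsto_const_nhds ?_ (fun _ => zero_le)
        (fun n => hnorm (by positivity) (by positivity) (hvw n) (hvwB n))
      -- Since `γ < β`, the exponent `1 - γ / β` is positive, so uniform convergence with bounded
      -- `β`-seminorms forces the `γ`-norm to zero.
      have hcont : Continuous fun t : ℝ =>
          ENNReal.ofReal (t + (2 * t) ^ (1 - γ / β) * (2 * A) ^ (γ / β)) :=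
        ENNReal.continuous_ofReal.comp (continuous_id.add
          (((continuous_const.mul continuous_id).rpow_const fun _ => Or.inr (by linarith)).mul
            continuous_const))
      have h0 := hcont.tendsto 0
      rw [mul_zero, Real.zero_rpow (by linarith), zero_mul, add_zero, ENNReal.ofReal_zero] at h0
      exact h0.comp (tendsto_pow_atTop_nhds_zero_of_lt_one (by norm_num) (by norm_num))

theorem eLpNorm_le_holderNorm (P : ℝ≥0∞) (γ : ℝ) (v : X → ℝ) :
    eLpNorm v P μ ≤ μ Set.univ ^ P.toReal⁻¹ * holderNorm d γ v := by
  rw [mul_comm]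
  refine eLpNorm_le_of_ae_enorm_bound (Eventually.of_forall fun x => ?_)
  rw [Real.enorm_eq_ofReal_abs]
  exact (le_iSup (fun x => ENNReal.ofReal |v x|) x).trans le_self_add

/-- On a finite measure space, compact embeddings into Hölder spaces are compact into `L^P`. -/
theorem EmbedsCompactly.lebesgue_of_holder {A : FunctionSpace X} {γ : ℝ}
    (h : EmbedsCompactly μ A (holderSpace d γ)) (hμ : μ Set.univ < ∞)
    (hA : ∀ u ∈ A.carrier, Measurable u) (P : ℝ≥0∞) :
    EmbedsCompactly μ A (lebesgueSpace μ P) := by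
  have hU : μ Set.univ ^ P.toReal⁻¹ ≠ ∞ := ENNReal.rpow_ne_top_of_nonneg (by positivity) hμ.ne
  have hmem : ∀ {v : X → ℝ}, v ∈ (holderSpace d γ).carrier → AEStronglyMeasurable v μ →
      MemLp v P μ := fun {v} hv hvm => ⟨hvm, (eLpNorm_le_holderNorm P γ v).trans_lt
        (ENNReal.mul_lt_top hU.lt_top hv)⟩
  obtain ⟨⟨K, hK⟩, hc⟩ := h
  refine ⟨⟨(μ Set.univ ^ P.toReal⁻¹).toNNReal * K, fun u hu => ?_⟩, fun u hu hR => ?_⟩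
  · obtain ⟨v, hv, hvu, hvn⟩ := hK u hu
    refine ⟨v, hmem hv ((hA u hu).aestronglyMeasurable.congr hvu.symm), hvu,
      (eLpNorm_le_holderNorm (d := d) P γ v).trans ?_⟩
    rw [ENNReal.coe_mul, ENNReal.coe_toNNReal hU, mul_assoc]
    gcongr
    exact hvn
  · obtain ⟨φ, hφ, v, hv, w, hw, hlim⟩ := hc u hu hR
    -- Measurability comes from `u`, through almost everywhere equality, and passes to `w` by
    -- pointwise convergence.
    have hvm : ∀ n, AEStronglyMeasurable (v n) μ := fun n =>
      (hA _ (hu _)).aestronglyMeasurable.congr (hv n).2.symm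
    have hpt : ∀ x, Tendsto (fun n => v n x) atTop (𝓝 (w x)) := fun x => by
      rw [tendsto_iff_edist_tendsto_0]
      refine tendsto_of_tendsto_of_tendsto_of_le_of_le tendsto_const_nhds hlim
        (fun _ => zero_le) fun n => ?_
      rw [edist_dist, Real.dist_eq]
      exact (le_iSup (fun x => ENNReal.ofReal |(v n - w) x|) x).trans le_self_add
    refine ⟨φ, hφ, v, fun n => ⟨hmem (hv n).1 (hvm n), (hv n).2⟩, w,
      hmem hw (aestronglyMeasurable_of_tendsto_ae atTop hvm (Eventually.of_forall hpt)), ?_⟩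
    refine tendsto_of_tendsto_of_tendsto_of_le_of_le tendsto_const_nhds ?_ (fun _ => zero_le)
      (fun n => eLpNorm_le_holderNorm (d := d) P γ (v n - w))
    have := ENNReal.Tendsto.const_mul hlim (Or.inr hU)
    rwa [mul_zero] at this

end

/-! ### Compactness in Lebesgue spaces -/

variable [MeasurableSpace X] {d : X → X → ℝ} {μ : Measure X} {C s α p : ℝ}

/-- Bounded sequences in `L^P` that tend to zero almost everywhere on a finite measure space tend
to zero in `L^r` for `r < P`. -/
theorem tendsto_eLpNorm_zero_of_bounded [IsFiniteMeasure μ] {r P : ℝ} (hr : 0 < r) (hrP : r < P)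
    {f : ℕ → X → ℝ} (hf : ∀ n, Measurable (f n)) {K : ℝ≥0∞} (hK : K ≠ ∞)
    (hfK : ∀ n, eLpNorm (f n) (ENNReal.ofReal P) μ ≤ K)
    (hlim : ∀ᵐ x ∂μ, Tendsto (fun n => f n x) atTop (𝓝 0)) :
    Tendsto (fun n => eLpNorm (f n) (ENNReal.ofReal r) μ) atTop (𝓝 0) := by
  have hP : 0 < P := hr.trans hrP
  have hη : 0 < 1 / r - 1 / P := sub_pos.2 (one_div_lt_one_div_of_lt hr hrP)
  -- The constant of the quasi-triangle inequality, needed because `r` may be below `1`.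
  set c := (ENNReal.ofReal r).LpAddConst with hc
  have hctop : c ≠ ∞ := (ENNReal.LpAddConst_lt_top _).ne
  set U := μ Set.univ ^ (ENNReal.ofReal r).toReal⁻¹ with hU
  have hUtop : U ≠ ∞ := ENNReal.rpow_ne_top_of_nonneg (by positivity) (measure_ne_top _ _)
  have hmeas : TendstoInMeasure μ f atTop fun _ => (0 : ℝ) :=
    tendstoInMeasure_of_tendsto_ae (fun n => (hf n).aestronglyMeasurable) hlim
  -- Where `|f n| ≥ ε`, Hölder's inequality gains a positive power of a measure tending to zero;
  -- elsewhere `|f n| < ε`.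
  have hbound : ∀ ε : ℝ≥0∞, ∀ n, eLpNorm (f n) (ENNReal.ofReal r) μ ≤
      c * (K * μ {x | ε ≤ edist (f n x) 0} ^ (1 / r - 1 / P) + ε * U) := fun ε n => by
    set S := {x | ε ≤ edist (f n x) 0} with hS
    have hSm : MeasurableSet S := measurableSet_le measurable_const ((hf n).edist measurable_const)
    have hsplit : f n = S.indicator (f n) + Sᶜ.indicator (f n) :=
      (Set.indicator_self_add_compl S (f n)).symm
    conv_lhs => rw [hsplit]
    refine (eLpNorm_add_le' ((hf n).indicator hSm).aestronglyMeasurable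
      ((hf n).indicator hSm.compl).aestronglyMeasurable _).trans ?_
    gcongr
    · rw [eLpNorm_indicator_eq_eLpNorm_restrict hSm]
      refine (eLpNorm_le_eLpNorm_mul_rpow_measure_univ (ENNReal.ofReal_le_ofReal hrP.le)
        (hf n).aestronglyMeasurable).trans ?_
      rw [Measure.restrict_apply_univ, ENNReal.toReal_ofReal hr.le, ENNReal.toReal_ofReal hP.le]
      gcongr
      exact (eLpNorm_mono_measure _ Measure.restrict_le_self).trans (hfK n)
    · refine eLpNorm_le_of_ae_enorm_bound (Eventually.of_forall fun x => ?_)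
      by_cases hx : x ∈ S
      · simp [hx]
      · rw [Set.indicator_of_mem (show x ∈ Sᶜ from hx)]
        simp only [hS, Set.mem_ofPred_eq, not_le, edist_zero_right] at hx
        exact hx.le
  rw [ENNReal.tendsto_nhds_zero]
  intro δ hδ
  have h1 : Tendsto (fun ε : ℝ≥0∞ => c * (ε * U)) (𝓝[>] 0) (𝓝 0) := by
    have : Tendsto (fun ε : ℝ≥0∞ => c * (ε * U)) (𝓝 0) (𝓝 (c * (0 * U))) :=
      ENNReal.Tendsto.const_mul (ENNReal.Tendsto.mul_const tendsto_id (Or.inr hUtop))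
        (Or.inr hctop)
    simpa using this.mono_left nhdsWithin_le_nhds
  obtain ⟨ε, hεδ, hε⟩ := ((h1.eventually_lt_const hδ).and self_mem_nhdsWithin).exists
  have h2 : Tendsto (fun n => c * (K * μ {x | ε ≤ edist (f n x) 0} ^ (1 / r - 1 / P) + ε * U))
      atTop (𝓝 (c * (K * 0 ^ (1 / r - 1 / P) + ε * U))) :=
    ENNReal.Tendsto.const_mul (Tendsto.add (ENNReal.Tendsto.const_mul
      ((ENNReal.continuous_rpow_const.tendsto 0).comp (hmeas ε hε)) (Or.inr hK))
        tendsto_const_nhds) (Or.inr hctop)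
  rw [ENNReal.zero_rpow_of_pos hη, mul_zero, zero_add] at h2
  exact (h2.eventually_lt_const hεδ).mono fun n hn => (hbound ε n).trans hn.le

/-- Bounded sequences in Hajłasz-Sobolev spaces have almost everywhere convergent subsequences. -/
theorem exists_subseq_tendsto_ae (hd : IsQuasiMetricWith d C)
    (htb : ∀ ε : ℝ, 0 < ε → ∃ F : Finset X, ∀ x, ∃ z ∈ F, d x z < ε)
    (hα : 0 < α) (hp : 0 < p) {u : ℕ → X → ℝ}
    (hu : ∀ n, u n ∈ (hajlaszSobolev d μ α (ENNReal.ofReal p)).carrier) {T : ℝ} (hT : 0 < T)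
    (hnorm : ∀ n, (hajlaszSobolev d μ α (ENNReal.ofReal p)).norm (u n) ≤ ENNReal.ofReal T) :
    ∃ φ : ℕ → ℕ, StrictMono φ ∧ ∃ w : X → ℝ, Measurable w ∧
      ∀ᵐ x ∂μ, Tendsto (fun n => u (φ n) x) atTop (𝓝 (w x)) := by
  choose h E H hint using fun n => exists_admissible hp (hu n) hT (hnorm n)
  set A : ℝ := 2 * (2 * T) ^ p with hA
  have hA0 : 0 < A := by positivity
  -- Chosen so that Chebyshev gives the complements of the good sets measure at most `2⁻¹ ^ j`,
  -- uniformly in `n`.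
  let l : ℕ → ℝ := fun j => (A * 2 ^ j) ^ (1 / p)
  have hl0 : ∀ j, 0 < l j := fun j => by positivity
  have hlp : ∀ j, l j ^ p = A * 2 ^ j := fun j => by
    rw [← Real.rpow_mul (by positivity), one_div, inv_mul_cancel₀ hp.ne', Real.rpow_one]
  let G : ℕ → ℕ → Set X := fun j n => {y | y ∉ E n ∧ h n y ≤ ENNReal.ofReal (l j)}
  have hG : ∀ j n, μ (G j n)ᶜ ≤ 2⁻¹ ^ j := fun j n => by
    have hpos : 0 < ENNReal.ofReal (l j) := ENNReal.ofReal_pos.2 (hl0 j)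
    calc μ (G j n)ᶜ ≤ μ (E n ∪ {y | ENNReal.ofReal (l j) ^ p ≤ h n y ^ p}) := by
          refine measure_mono fun y hy => ?_
          by_cases hyE : y ∈ E n
          · exact Or.inl hyE
          · refine Or.inr (ENNReal.rpow_le_rpow ?_ hp.le)
            by_contra! hcon
            exact hy ⟨hyE, hcon.le⟩
      _ ≤ μ (E n) + μ {y | ENNReal.ofReal (l j) ^ p ≤ h n y ^ p} := measure_union_le _ _
      _ = μ {y | ENNReal.ofReal (l j) ^ p ≤ h n y ^ p} := by rw [(H n).measure_zero, zero_add]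
      _ ≤ (∫⁻ y, h n y ^ p ∂μ) / ENNReal.ofReal (l j) ^ p :=
          meas_ge_le_lintegral_div ((H n).measurable.pow_const p).aemeasurable
            (ENNReal.rpow_pos hpos ENNReal.ofReal_ne_top).ne'
            (ENNReal.rpow_ne_top_of_nonneg hp.le ENNReal.ofReal_ne_top)
      _ ≤ ENNReal.ofReal A / ENNReal.ofReal (l j) ^ p := by gcongr; exact hint n
      _ = 2⁻¹ ^ j := by
          rw [ENNReal.ofReal_rpow_of_pos (hl0 j), hlp, ← ENNReal.ofReal_div_of_pos (by positivity),
            div_mul_cancel_left₀ hA0.ne', ← inv_pow, ENNReal.ofReal_pow (by positivity),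
            ENNReal.ofReal_inv_of_pos two_pos, ENNReal.ofReal_ofNat]
  obtain ⟨φ, hφ, hcau⟩ := hd.exists_subseq_cauchy htb hα u G (fun j => 2 * l j)
    (fun j n x hx y hy => (H n).abs_sub_le hd.nonneg (hl0 j).le hx hy)
    (fun j n x hx => ((H n).abs_le_real (hl0 j).le hx.2).trans (by linarith [hl0 j]))
  -- Borel–Cantelli: almost every point is eventually good for two consecutive terms, whose
  -- difference is then at most `(1 / 2) ^ j`, which is summable.
  have hBC : ∀ᵐ x ∂μ, ∀ᶠ j in atTop, x ∉ (G j (φ j))ᶜ ∪ (G j (φ (j + 1)))ᶜ := by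
    refine ae_eventually_notMem (ne_top_of_le_ne_top ?_ (ENNReal.tsum_le_tsum fun j =>
      (measure_union_le _ _).trans (add_le_add (hG j _) (hG j _))))
    rw [ENNReal.tsum_add, ENNReal.tsum_geometric, ENNReal.one_sub_inv_two, inv_inv]
    finiteness
  have hconv : ∀ᵐ x ∂μ, ∃ l, Tendsto (fun n => u (φ n) x) atTop (𝓝 l) := by
    filter_upwards [hBC] with x hx
    refine cauchySeq_tendsto_of_complete (cauchySeq_of_summable_dist ?_)
    refine Summable.of_norm_bounded_eventually_nat (g := fun j => (1 / 2 : ℝ) ^ j)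
      summable_geometric_two (hx.mono fun j hj => ?_)
    simp only [Set.mem_union, Set.mem_compl_iff, not_or, not_not] at hj
    rw [Real.norm_of_nonneg dist_nonneg, Real.dist_eq]
    exact hcau j j (j + 1) le_rfl (Nat.le_succ j) x hj
  obtain ⟨w, hw, hwlim⟩ := measurable_limit_of_tendsto_metrizable_ae
    (fun n => (hu (φ n)).1.aemeasurable) hconv
  exact ⟨φ, hφ, w, hw, hwlim⟩

/-- Compactness of the Sobolev embedding below the critical exponent. -/
theorem embedsCompactly_lebesgue (hd : IsQuasiMetricWith d C) (hμ : μ Set.univ < ∞)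
    (htb : ∀ ε : ℝ, 0 < ε → ∃ F : Finset X, ∀ x, ∃ z ∈ F, d x z < ε)
    (hs : 0 < s) (hreg : IsLocallyLowerAhlforsRegular d μ s) (hα : 0 < α) (hp : 0 < p)
    (hsub : α * p < s) {r : ℝ} (hr : 0 < r) (hrP : r < s * p / (s - α * p)) :
    EmbedsCompactly μ (hajlaszSobolev d μ α (ENNReal.ofReal p))
      (lebesgueSpace μ (ENNReal.ofReal r)) := by
  have : IsFiniteMeasure μ := ⟨hμ⟩
  obtain ⟨K, hK⟩ := exists_eLpNorm_le hd hμ hs hreg hα hp hsub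
  set P := s * p / (s - α * p)
  have hle : ENNReal.ofReal r ≤ ENNReal.ofReal P := ENNReal.ofReal_le_ofReal hrP.le
  refine ⟨?_, fun u hu ⟨R, hR⟩ => ?_⟩
  · have hη : 0 ≤ 1 / r - 1 / P := sub_nonneg.2 (one_div_le_one_div_of_le hr hrP.le)
    have hU : μ Set.univ ^ (1 / r - 1 / P) ≠ ∞ := ENNReal.rpow_ne_top_of_nonneg hη hμ.ne
    refine embedsContinuously_of_forall hp (MemLp.zero' (ε := ℝ)) (by simp [lebesgueSpace])
      ((μ Set.univ ^ (1 / r - 1 / P)).toNNReal * K) fun u hu T hT hn => ?_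
    have hmem : MemLp u (ENNReal.ofReal P) μ :=
      ⟨hu.1.aestronglyMeasurable, (hK u hu T hT hn).trans_lt (by finiteness)⟩
    refine ⟨u, hmem.mono_exponent hle, EventuallyEq.rfl, ?_⟩
    refine (eLpNorm_le_eLpNorm_mul_rpow_measure_univ hle hu.1.aestronglyMeasurable).trans ?_
    rw [ENNReal.toReal_ofReal hr.le, ENNReal.toReal_ofReal (hr.trans hrP).le, ENNReal.coe_mul,
      ENNReal.coe_toNNReal hU, mul_comm, mul_assoc]
    gcongr
    exact hK u hu T hT hn
  · have hT : (0 : ℝ) < R + 1 := by positivity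
    have hR' : ∀ n, (hajlaszSobolev d μ α (ENNReal.ofReal p)).norm (u n) ≤
        ENNReal.ofReal ((R : ℝ) + 1) := fun n => (hR n).trans (by
      rw [← ENNReal.ofReal_coe_nnreal]; exact ENNReal.ofReal_le_ofReal (by linarith))
    obtain ⟨φ, hφ, w, hw, hlim⟩ := exists_subseq_tendsto_ae hd htb hα hp hu hT hR'
    have hum : ∀ n, AEStronglyMeasurable (u n) μ := fun n => (hu n).1.aestronglyMeasurable
    have hbd : ∀ n, eLpNorm (u n) (ENNReal.ofReal P) μ ≤ K * ENNReal.ofReal ((R : ℝ) + 1) :=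
      fun n => hK _ (hu n) _ hT (hR' n)
    have hbtop : K * ENNReal.ofReal ((R : ℝ) + 1) ≠ ∞ := by finiteness
    -- The Fatou property carries the bound to the limit.
    have hwbd : eLpNorm w (ENNReal.ofReal P) μ ≤ K * ENNReal.ofReal ((R : ℝ) + 1) :=
      (Lp.eLpNorm_lim_le_liminf_eLpNorm (fun n => hum (φ n)) w hlim).trans
        (liminf_le_of_le (by isBoundedDefault) fun b hb => by
          obtain ⟨n, hn⟩ := hb.exists
          exact hn.trans (hbd _))
    have hmem : ∀ {v : X → ℝ}, AEStronglyMeasurable v μ →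
        eLpNorm v (ENNReal.ofReal P) μ ≤ K * ENNReal.ofReal ((R : ℝ) + 1) →
        MemLp v (ENNReal.ofReal r) μ := fun {v} hv hvb =>
      MemLp.mono_exponent ⟨hv, hvb.trans_lt hbtop.lt_top⟩ hle
    refine ⟨φ, hφ, fun n => u (φ n), fun n => ⟨hmem (hum _) (hbd _), EventuallyEq.rfl⟩, w,
      hmem hw.aestronglyMeasurable hwbd, ?_⟩
    refine tendsto_eLpNorm_zero_of_bounded hr hrP (fun n => (hu _).1.sub hw)
      (K := (ENNReal.ofReal P).LpAddConst *
        (K * ENNReal.ofReal ((R : ℝ) + 1) + K * ENNReal.ofReal ((R : ℝ) + 1)))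
      (ENNReal.mul_ne_top (ENNReal.LpAddConst_lt_top _).ne (by finiteness)) (fun n => ?_) ?_
    · refine (eLpNorm_sub_le' (hum _) hw.aestronglyMeasurable _).trans ?_
      gcongr
      exact hbd _
    · filter_upwards [hlim] with x hx
      simpa using hx.sub_const (w x)

end QMM

/-! ### Assembly, with the choice of `α'` for the Besov scale -/

theorem mainTheorem6 {X : Type*} [MeasurableSpace X] (d : X → X → ℝ) (μ : Measure X)
    (hX : QMM.IsQuasiMetricMeasureSpace d μ) (hμ : μ Set.univ < ∞)
    (s : ℝ) (hs : 0 < s) (hreg : QMM.IsLocallyLowerAhlforsRegular d μ s)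
    (α p : ℝ) (hα : 0 < α) (hp : 0 < p) :
    (α * p < s →
      QMM.EmbedsContinuously μ (QMM.hajlaszSobolev d μ α (ENNReal.ofReal p))
        (QMM.lebesgueSpace μ (ENNReal.ofReal (s * p / (s - α * p)))) ∧
      ∀ p' : ℝ, 0 < p' → p' < s * p / (s - α * p) →
        QMM.EmbedsCompactly μ (QMM.hajlaszSobolev d μ α (ENNReal.ofReal p))
          (QMM.lebesgueSpace μ (ENNReal.ofReal p')) ∧
        ∀ q : ℝ≥0∞, 0 < q →
          QMM.EmbedsCompactly μ (QMM.hajlaszTriebelLizorkin d μ α (ENNReal.ofReal p) q)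
            (QMM.lebesgueSpace μ (ENNReal.ofReal p')) ∧
          QMM.EmbedsCompactly μ (QMM.hajlaszBesov d μ α (ENNReal.ofReal p) q)
            (QMM.lebesgueSpace μ (ENNReal.ofReal p'))) ∧
    (s < α * p →
      QMM.EmbedsContinuously μ (QMM.hajlaszSobolev d μ α (ENNReal.ofReal p))
        (QMM.holderSpace d (α - s / p)) ∧
      (∀ γ : ℝ, 0 < γ → γ < α - s / p →
        QMM.EmbedsCompactly μ (QMM.hajlaszSobolev d μ α (ENNReal.ofReal p))
          (QMM.holderSpace d γ) ∧
        ∀ q : ℝ≥0∞, 0 < q →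
          QMM.EmbedsCompactly μ (QMM.hajlaszTriebelLizorkin d μ α (ENNReal.ofReal p) q)
            (QMM.holderSpace d γ) ∧
          QMM.EmbedsCompactly μ (QMM.hajlaszBesov d μ α (ENNReal.ofReal p) q)
            (QMM.holderSpace d γ)) ∧
      ∀ p' : ℝ, 0 < p' →
        QMM.EmbedsCompactly μ (QMM.hajlaszSobolev d μ α (ENNReal.ofReal p))
          (QMM.lebesgueSpace μ (ENNReal.ofReal p')) ∧
        ∀ q : ℝ≥0∞, 0 < q →
          QMM.EmbedsCompactly μ (QMM.hajlaszTriebelLizorkin d μ α (ENNReal.ofReal p) q)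
            (QMM.lebesgueSpace μ (ENNReal.ofReal p')) ∧
          QMM.EmbedsCompactly μ (QMM.hajlaszBesov d μ α (ENNReal.ofReal p) q)
            (QMM.lebesgueSpace μ (ENNReal.ofReal p'))) := by
  obtain ⟨C, hd⟩ := hX.quasiMetric.exists_with
  have htb := QMM.exists_finite_net hd hX hμ hreg
  obtain ⟨D, hD⟩ := QMM.exists_dist_lt hd htb
  refine ⟨fun hsub => ⟨QMM.sobolev_embedsContinuously hd hμ hs hreg hα hp hsub,
    fun r hr hrP => ?_⟩, fun hsup => ?_⟩
  · have hM := QMM.embedsCompactly_lebesgue hd hμ htb hs hreg hα hp hsub hr hrP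
    refine ⟨hM, fun q hq => ⟨hM.triebelLizorkin hd hq, ?_⟩⟩
    -- For `α' * p < s`, the condition `r < s * p / (s - α' * p)` amounts to `s / p - s / r < α'`,
    -- so a positive `α' < α` still has critical exponent above `r`.
    have hlow : max 0 (s / p - s / r) < α := by
      rw [lt_div_iff₀ (by linarith)] at hrP
      rw [max_lt_iff, sub_lt_iff_lt_add, div_lt_iff₀ hp]
      refine ⟨hα, ?_⟩
      rw [← mul_lt_mul_iff_of_pos_right hr]
      field_simp
      nlinarith
    obtain ⟨α', h1, h2⟩ := exists_between hlow
    rw [max_lt_iff] at h1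
    have hsub' : α' * p < s := (mul_lt_mul_of_pos_right h2 hp).trans hsub
    refine QMM.EmbedsCompactly.besov hd hD hp hq h2
      (QMM.embedsCompactly_lebesgue hd hμ htb hs hreg h1.1 hp hsub' hr ?_)
    rw [lt_div_iff₀ (by linarith)]
    have h3 := h1.2
    rw [div_sub_div _ _ hp.ne' hr.ne', div_lt_iff₀ (by positivity)] at h3
    nlinarith
  · have hH : ∀ γ : ℝ, 0 < γ → γ < α - s / p →
        QMM.EmbedsCompactly μ (QMM.hajlaszSobolev d μ α (ENNReal.ofReal p))
          (QMM.holderSpace d γ) ∧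
        ∀ q : ℝ≥0∞, 0 < q →
          QMM.EmbedsCompactly μ (QMM.hajlaszTriebelLizorkin d μ α (ENNReal.ofReal p) q)
            (QMM.holderSpace d γ) ∧
          QMM.EmbedsCompactly μ (QMM.hajlaszBesov d μ α (ENNReal.ofReal p) q)
            (QMM.holderSpace d γ) := fun γ hγ hγβ => by
      have hM := QMM.embedsCompactly_holder hd htb hs hreg hα hp hsup hγ hγβ
      refine ⟨hM, fun q hq => ⟨hM.triebelLizorkin hd hq, ?_⟩⟩
      -- This keeps `γ` below the reduced Hölder exponent `α' - s / p`.
      obtain ⟨α', h1, h2⟩ := exists_between (show γ + s / p < α by linarith)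
      have hsp : 0 < s / p := by positivity
      refine QMM.EmbedsCompactly.besov hd hD hp hq h2
        (QMM.embedsCompactly_holder hd htb hs hreg (by linarith) hp ?_ hγ (by linarith))
      rw [← div_lt_iff₀ hp]
      linarith
    have hβ : 0 < α - s / p := by rw [sub_pos, div_lt_iff₀ hp]; exact hsup
    refine ⟨QMM.holder_embedsContinuously hd hs hreg hα hp hsup, hH, fun r _ => ?_⟩
    obtain ⟨hM, hTB⟩ := hH ((α - s / p) / 2) (by linarith) (by linarith)
    exact ⟨hM.lebesgue_of_holder hμ (fun u hu => hu.1) _, fun q hq =>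
      ⟨(hTB q hq).1.lebesgue_of_holder hμ (fun u hu => hu.1) _,
        (hTB q hq).2.lebesgue_of_holder hμ (fun u hu => hu.1) _⟩⟩
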